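/- **Theorem B'.** A *marked linkage* $\mathcal L=(L,\ell,W)$ is a finite graph $L$ without loops, with a positive length $\ell(e)$ on each edge and an ordered list $W=(w_1,\dots,w_s)$ of distinct fixed vertices. For $Z\in\mathbb C^s$, the relative configuration space $C(\mathcal L,Z)$ is the set of maps $\phi$ from the vertices of $L$ to $\mathbb C=\mathbb R^2$ such that $|\phi(v)-\phi(w)|^2=\ell([vw])^2$ for every edge $[vw]$ and $\phi(w_j)=z_j$ for all $j$. If $m$ distinct input vertices $P_1,\dots,P_m$ are chosen, the *input map* is $p(\phi)=(\phi(P_1),\dots,\phi(P_m))\in\mathbb C^m$. Let $S\subset\mathbb C^m$ be a complex algebraic set, treated as a real algebraic set, and let $U$ be a bounded subset of $S$ that is open in $S$ in the classical topology. Then there are a marked linkage $\mathcal L_0$, a vector $Z$ and $m$ distinct input vertices such that the input map $p_0$ is a map $X:=C(\mathcal L_0,Z)\to S$ that is an analytically trivial polynomial covering over $U$. That is: 1. $p_0$ is a (real) polynomial map with $p_0(X)\subset S$ and $U\subset p_0(X)$; 2. $p_0^{-1}(U)$ is the disjoint union of finitely many relatively open sheets, each of which $p_0$ maps real-analytically isomorphically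 onto $U$; moreover $p_0$ maps each connected component of $p_0^{-1}(U)$ real-analytically isomorphically onto a connected component of $U$; 3. there is a finite group $G$ of (real) polynomial automorphisms $\sigma$ of $X$ with $p_0\circ\sigma=p_0$ that acts simply transitively on the fibre of $p_0$ over each point of $U$. -/

import Mathlib

/-- An abstract marked linkage on the vertex set `V`: a graph without loops, a positive length
on every edge, and an ordered set of pairwise distinct fixed vertices (the marking). -/
structure MarkedLinkage (V : Type) where
  /-- the underlying graph -/
  graph : SimpleGraph V
  /-- the edge lengths -/
  length : graph.edgeSet → ℝ
  length_pos : ∀ e, 0 < length e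
  /-- the number of fixed vertices -/
  numFixed : ℕ
  /-- the fixed vertices -/
  fixed : Fin numFixed ↪ V

/-- A planar realization of a linkage: a map from the vertices to the plane `ℂ` that sends the
endpoints of every edge to points at distance the length of the edge. -/
def MarkedLinkage.IsRealization {V : Type} (L : MarkedLinkage V) (φ : V → ℂ) : Prop :=
  ∀ (v w : V) (h : L.graph.Adj v w), ‖φ v - φ w‖ ^ 2 = L.length ⟨s(v, w), h⟩ ^ 2

/-- The relative configuration space `C(L, Z)`: the realizations that send the `j`-th fixed vertex
to the prescribed point `Z j`. -/
def MarkedLinkage.configSpace {V : Type} (L : MarkedLinkage V) (Z : Fin L.numFixed → ℂ) :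
    Set (V → ℂ) :=
  {φ | L.IsRealization φ ∧ ∀ j, φ (L.fixed j) = Z j}

/-- The input map for the input vertices `P 0, …, P (m - 1)`: it records the positions of the input
vertices. -/
def inputMap {V : Type} {m : ℕ} (P : Fin m ↪ V) (φ : V → ℂ) : Fin m → ℂ :=
  fun i => φ (P i)

/-- A complex algebraic subset of `ℂ^m`: the set of common zeros of an ideal of polynomials. -/
def IsComplexAlgebraicSet {m : ℕ} (S : Set (Fin m → ℂ)) : Prop :=
  ∃ I : Ideal (MvPolynomial (Fin m) ℂ), S = MvPolynomial.zeroLocus ℂ I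

/-- The real coordinates of a point of `ℂ^ι`: real parts, followed by imaginary parts. -/
def realCoords {ι : Type} (x : ι → ℂ) : ι ⊕ ι → ℝ :=
  Sum.elim (fun i => (x i).re) (fun i => (x i).im)

/-- The map `f`, defined on the subset `X` of `ℂ^ι = ℝ^{2ι}`, with values in `ℂ^κ = ℝ^{2κ}`, is the
restriction to `X` of a map given by real polynomials in the real coordinates. -/
def IsRealPolynomialMap {ι κ : Type} (X : Set (ι → ℂ)) (f : X → (κ → ℂ)) : Prop :=
  ∃ P : κ ⊕ κ → MvPolynomial (ι ⊕ ι) ℝ,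
    ∀ (x : X) (j : κ ⊕ κ), realCoords (f x) j = MvPolynomial.eval (realCoords x.1) (P j)

/-- The restriction of `f` to `A` is a real-analytic isomorphism of `A` onto `B`. A map on an
arbitrary subset is analytic if near each point of the subset it is the restriction of the sum of
a convergent power series of the ambient real vector space (`AnalyticOn`). -/
def IsAnalyticIsoOn {E F : Type} [NormedAddCommGroup E] [NormedSpace ℝ E]
    [NormedAddCommGroup F] [NormedSpace ℝ F] (f : E → F) (A : Set E) (B : Set F) : Prop :=
  Set.MapsTo f A B ∧ AnalyticOn ℝ f A ∧
    ∃ g : F → E, Set.MapsTo g B A ∧ AnalyticOn ℝ g B ∧ Set.InvOn g f A B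

/-- The restriction of `f` to `A` is a finite analytically trivial covering of `B`. -/
structure IsAnalyticallyTrivialCovering {E F : Type} [NormedAddCommGroup E] [NormedSpace ℝ E]
    [NormedAddCommGroup F] [NormedSpace ℝ F] (f : E → F) (A : Set E) (B : Set F) : Prop where
  /-- `A` is the disjoint union of finitely many relatively open sheets, each of which `f` maps
  analytically isomorphically onto `B` -/
  sheets : ∃ (n : ℕ) (T : Fin n → Set E),
    A = ⋃ i, T i ∧ Pairwise (fun i j => Disjoint (T i) (T j)) ∧
      (∀ i, ∃ O : Set E, IsOpen O ∧ T i = A ∩ O) ∧ ∀ i, IsAnalyticIsoOn f (T i) B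
  /-- `f` maps every connected component of `A` analytically isomorphically onto a connected
  component of `B` -/
  components : ∀ x ∈ A,
    IsAnalyticIsoOn f (connectedComponentIn A x) (connectedComponentIn B (f x))

/-- Let `X ⊆ ℂ^ι` and `Y ⊆ ℂ^κ` be real algebraic sets, `U` an open subset of `Y`, and `f` a map.
This says that `f` restricts to a polynomial morphism `X → Y` which is an analytically trivial
polynomial covering over `U`: its restriction to the preimage of `U` is an analytically trivial
covering of `U`, and this covering is regular, its group of covering transformations being (the
restriction of) a finite group `G` of polynomial automorphisms of `X`. -/
structure IsAnalyticallyTrivialPolynomialCoveringOver {ι κ : Type} [Fintype ι] [Fintype κ]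
    (f : (ι → ℂ) → (κ → ℂ)) (X : Set (ι → ℂ)) (Y U : Set (κ → ℂ)) : Prop where
  mapsTo : Set.MapsTo f X Y
  polynomial : IsRealPolynomialMap X (fun x => f x)
  trivial : IsAnalyticallyTrivialCovering f (X ∩ f ⁻¹' U) U
  /-- every point of `U` is covered -/
  surj : ∀ u ∈ U, ∃ x ∈ X, f x = u
  /-- `G` acts on `X` by polynomial automorphisms over `Y`, and simply transitively on the fibre
  over each point of `U` -/
  regular : ∃ G : Subgroup (Equiv.Perm X), Finite G ∧
    (∀ σ ∈ G, IsRealPolynomialMap X (fun x => (σ x : ι → ℂ))) ∧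
    (∀ σ ∈ G, ∀ x : X, f (σ x) = f x) ∧
    ∀ x y : X, f x ∈ U → f x = f y → ∃! σ : Equiv.Perm X, σ ∈ G ∧ σ x = y

/-- A complex-valued function on `ℂ^ι` whose real and imaginary parts are real polynomials in the
real coordinates. -/
def RealPoly {ι : Type} (f : (ι → ℂ) → ℂ) : Prop :=
  ∃ p q : MvPolynomial (ι ⊕ ι) ℝ, ∀ x,
    (f x).re = MvPolynomial.eval (realCoords x) p ∧ (f x).im = MvPolynomial.eval (realCoords x) q

namespace RealPoly

variable {ι κ : Type} {f g : (ι → ℂ) → ℂ}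

theorem proj (i : ι) : RealPoly (fun x : ι → ℂ => x i) :=
  ⟨.X (.inl i), .X (.inr i), fun x => by simp [realCoords]⟩

theorem const (c : ℂ) : RealPoly (fun _ : ι → ℂ => c) :=
  ⟨.C c.re, .C c.im, fun x => by simp⟩

theorem add (hf : RealPoly f) (hg : RealPoly g) : RealPoly (fun x => f x + g x) := by
  obtain ⟨p, q, h⟩ := hf
  obtain ⟨p', q', h'⟩ := hg
  exact ⟨p + p', q + q', fun x => by simp [h, h']⟩

theorem mul (hf : RealPoly f) (hg : RealPoly g) : RealPoly (fun x => f x * g x) := by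
  obtain ⟨p, q, h⟩ := hf
  obtain ⟨p', q', h'⟩ := hg
  exact ⟨p * p' - q * q', p * q' + q * p', fun x => by simp [h, h']⟩

theorem const_mul (c : ℂ) (hf : RealPoly f) : RealPoly (fun x => c * f x) :=
  (RealPoly.const c).mul hf

theorem neg (hf : RealPoly f) : RealPoly (fun x => -f x) := by
  simpa using hf.const_mul (-1)

theorem sub (hf : RealPoly f) (hg : RealPoly g) : RealPoly (fun x => f x - g x) := by
  simpa [sub_eq_add_neg] using hf.add hg.neg

theorem div_const (hf : RealPoly f) (c : ℂ) : RealPoly (fun x => f x / c) := by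
  simpa [div_eq_inv_mul] using hf.const_mul c⁻¹

theorem comp {g : (κ → ℂ) → ℂ} (hg : RealPoly g) {F : (ι → ℂ) → (κ → ℂ)}
    (hF : ∀ j, RealPoly (fun x => F x j)) : RealPoly (fun x => g (F x)) := by
  obtain ⟨p, q, h⟩ := hg
  choose P Q hPQ using hF
  have key : ∀ x, realCoords (F x) =
      fun j => MvPolynomial.eval (realCoords x) (Sum.elim P Q j) := by
    intro x
    ext j
    rcases j with j | j
    · simpa [realCoords] using (hPQ j x).1
    · simpa [realCoords] using (hPQ j x).2
  refine ⟨MvPolynomial.bind₁ (Sum.elim P Q) p, MvPolynomial.bind₁ (Sum.elim P Q) q, fun x => ?_⟩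
  simp only [(h _).1, (h _).2, key, MvPolynomial.eval, MvPolynomial.eval₂Hom_bind₁]
  exact ⟨trivial, trivial⟩

theorem analyticOnNhd [Fintype ι] (hf : RealPoly f) (s : Set (ι → ℂ)) : AnalyticOnNhd ℝ f s := by
  obtain ⟨p, q, h⟩ := hf
  have hc : ∀ j : ι ⊕ ι, AnalyticOnNhd ℝ (fun x : ι → ℂ => realCoords x j) s := by
    rintro (j | j)
    · exact (Complex.reCLM.comp
        (ContinuousLinearMap.proj (R := ℝ) (φ := fun _ : ι => ℂ) j)).analyticOnNhd s
    · exact (Complex.imCLM.comp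
        (ContinuousLinearMap.proj (R := ℝ) (φ := fun _ : ι => ℂ) j)).analyticOnNhd s
  have hp : ∀ r : MvPolynomial (ι ⊕ ι) ℝ,
      AnalyticOnNhd ℝ (fun x : ι → ℂ => MvPolynomial.eval (realCoords x) r) s :=
    fun r => AnalyticOnNhd.aeval_mvPolynomial hc r
  have e : f = fun x => Complex.ofRealCLM (MvPolynomial.eval (realCoords x) p) +
      Complex.I * Complex.ofRealCLM (MvPolynomial.eval (realCoords x) q) := by
    ext x
    rw [← (h x).1, ← (h x).2, mul_comm]
    simp [Complex.re_add_im]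
  rw [e]
  exact ((Complex.ofRealCLM.analyticOnNhd Set.univ).comp (hp p) (Set.mapsTo_univ _ _)).add
    (analyticOnNhd_const.mul
      ((Complex.ofRealCLM.analyticOnNhd Set.univ).comp (hp q) (Set.mapsTo_univ _ _)))

end RealPoly

/-- A map all of whose components are real polynomials. -/
def RealPolyMap {ι κ : Type} (F : (ι → ℂ) → (κ → ℂ)) : Prop :=
  ∀ j, RealPoly (fun x => F x j)

namespace RealPolyMap

variable {ι κ ν : Type}

theorem comp {G : (κ → ℂ) → (ν → ℂ)} {F : (ι → ℂ) → (κ → ℂ)} (hG : RealPolyMap G)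
    (hF : RealPolyMap F) : RealPolyMap (fun x => G (F x)) :=
  fun j => (hG j).comp hF

theorem reindex (ρ : κ → ι) : RealPolyMap (fun x : ι → ℂ => x ∘ ρ) :=
  fun j => RealPoly.proj (ρ j)

theorem analyticOn [Fintype ι] [Fintype κ] {F : (ι → ℂ) → (κ → ℂ)} (hF : RealPolyMap F)
    (s : Set (ι → ℂ)) : AnalyticOn ℝ F s :=
  (AnalyticOnNhd.pi fun j => (hF j).analyticOnNhd s).analyticOn

theorem isRealPolynomialMap {F : (ι → ℂ) → (κ → ℂ)} (hF : RealPolyMap F) (X : Set (ι → ℂ)) :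
    IsRealPolynomialMap X (fun x => F x) := by
  choose P Q h using hF
  refine ⟨Sum.elim P Q, fun x j => ?_⟩
  rcases j with j | j
  · simpa [realCoords] using (h j x).1
  · simpa [realCoords] using (h j x).2

end RealPolyMap

/-- A subset of `ℂ^V` cut out by equations that prescribe a positive distance between two
coordinates or the value of a coordinate. -/
def IsConfig {V : Type} (X : Set (V → ℂ)) : Prop :=
  ∃ (E : Set (V × V × ℝ)) (F : Set (V × ℂ)), (∀ e ∈ E, 0 < e.2.2) ∧
    X = {φ | (∀ e ∈ E, ‖φ e.1 - φ e.2.1‖ = e.2.2) ∧ ∀ f ∈ F, φ f.1 = f.2}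

namespace IsConfig

variable {V V' : Type}

theorem univ : IsConfig (Set.univ : Set (V → ℂ)) :=
  ⟨∅, ∅, by simp, by simp⟩

theorem dist (v w : V) {l : ℝ} (hl : 0 < l) : IsConfig {φ : V → ℂ | ‖φ v - φ w‖ = l} :=
  ⟨{(v, w, l)}, ∅, by simpa, by simp⟩

theorem fixed (v : V) (c : ℂ) : IsConfig {φ : V → ℂ | φ v = c} :=
  ⟨∅, {(v, c)}, by simp, by simp⟩

theorem iInter {ι : Sort*} {X : ι → Set (V → ℂ)} (h : ∀ i, IsConfig (X i)) :
    IsConfig (⋂ i, X i) := by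
  choose E F hE hX using h
  refine ⟨⋃ i, E i, ⋃ i, F i, ?_, ?_⟩
  · simp only [Set.mem_iUnion]
    rintro e ⟨i, hi⟩
    exact hE i e hi
  · ext φ
    simp only [Set.mem_iInter, Set.mem_iUnion, Set.mem_ofPred_eq]
    constructor
    · intro h
      refine ⟨?_, ?_⟩
      · rintro e ⟨i, hi⟩
        have := h i
        rw [hX i] at this
        exact this.1 e hi
      · rintro e ⟨i, hi⟩
        have := h i
        rw [hX i] at this
        exact this.2 e hi
    · rintro ⟨h1, h2⟩ i
      rw [hX i]
      exact ⟨fun e he => h1 e ⟨i, he⟩, fun e he => h2 e ⟨i, he⟩⟩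

theorem inter {X Y : Set (V → ℂ)} (hX : IsConfig X) (hY : IsConfig Y) : IsConfig (X ∩ Y) := by
  rw [Set.inter_eq_iInter]
  exact iInter (by rintro (_ | _) <;> assumption)

theorem and {p q : (V → ℂ) → Prop} (hp : IsConfig {φ | p φ}) (hq : IsConfig {φ | q φ}) :
    IsConfig {φ | p φ ∧ q φ} :=
  hp.inter hq

theorem reindex {X : Set (V → ℂ)} (hX : IsConfig X) (ρ : V → V') :
    IsConfig {φ : V' → ℂ | φ ∘ ρ ∈ X} := by
  obtain ⟨E, F, hE, rfl⟩ := hX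
  refine ⟨(fun e => (ρ e.1, ρ e.2.1, e.2.2)) '' E, (fun f => (ρ f.1, f.2)) '' F, ?_, ?_⟩
  · rintro _ ⟨e, he, rfl⟩
    exact hE e he
  · ext φ
    simp only [Set.mem_ofPred_eq, Set.forall_mem_image, Function.comp_apply]

theorem exists_linkage [Fintype V] {X : Set (V → ℂ)} (hX : IsConfig X) (hne : X.Nonempty) :
    ∃ (L : MarkedLinkage V) (Z : Fin L.numFixed → ℂ), L.configSpace Z = X := by
  obtain ⟨E, F, hE, rfl⟩ := hX
  obtain ⟨φ₀, h1, h2⟩ := hne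
  classical
  let len : Sym2 V → ℝ := Sym2.lift ⟨fun v w => ‖φ₀ v - φ₀ w‖, fun v w => norm_sub_rev _ _⟩
  let R : V → V → Prop := fun v w => ∃ l, (v, w, l) ∈ E ∨ (w, v, l) ∈ E
  have hR : ∀ v w, R v w → 0 < ‖φ₀ v - φ₀ w‖ := by
    rintro v w ⟨l, h | h⟩
    · rw [h1 _ h]; exact hE _ h
    · rw [norm_sub_rev, h1 _ h]; exact hE _ h
  let G : SimpleGraph V :=
    { Adj := R
      symm := ⟨fun v w ⟨l, h⟩ => ⟨l, h.symm⟩⟩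
      loopless := ⟨fun v h => by simpa using hR v v h⟩ }
  let S := {v : V // ∃ c, (v, c) ∈ F}
  let L : MarkedLinkage V :=
    { graph := G
      length := fun e => len e.1
      length_pos := by
        rintro ⟨e, he⟩
        induction e using Sym2.ind with
        | _ v w => exact hR v w he
      numFixed := Fintype.card S
      fixed := (Fintype.equivFin S).symm.toEmbedding.trans (Function.Embedding.subtype _) }
  refine ⟨L, fun j => φ₀ (L.fixed j), ?_⟩
  ext φ
  constructor
  · rintro ⟨hr, hf⟩
    refine ⟨fun e he => ?_, fun f hf' => ?_⟩
    · have : ‖φ e.1 - φ e.2.1‖ ^ 2 = ‖φ₀ e.1 - φ₀ e.2.1‖ ^ 2 := hr e.1 e.2.1 ⟨e.2.2, Or.inl he⟩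
      rw [← h1 e he]
      exact (sq_eq_sq₀ (norm_nonneg _) (norm_nonneg _)).1 this
    · rw [← h2 f hf']
      have := hf (Fintype.equivFin S ⟨f.1, f.2, hf'⟩)
      simp only [L, Function.Embedding.trans_apply, Equiv.coe_toEmbedding,
        Equiv.symm_apply_apply] at this
      exact this
  · rintro ⟨hd, hf⟩
    refine ⟨?_, fun j => ?_⟩
    · rintro v w ⟨l, h | h⟩
      · change ‖φ v - φ w‖ ^ 2 = ‖φ₀ v - φ₀ w‖ ^ 2
        rw [hd _ h, h1 _ h]
      · change ‖φ v - φ w‖ ^ 2 = ‖φ₀ v - φ₀ w‖ ^ 2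
        rw [norm_sub_rev, hd _ h, norm_sub_rev (φ₀ v), h1 _ h]
    · obtain ⟨c, hc⟩ := ((Fintype.equivFin S).symm j).2
      exact (hf _ hc).trans (h2 _ hc).symm

end IsConfig

/-- A set `X` of points of `ℂ^K × ℂ^W` together with a finite group of real polynomial
automorphisms of `X` over `ℂ^K`, which is simply transitive on the fibres over `D`, and an analytic
section over `D`. -/
structure PolyCover (K W : Type) [Fintype K] [Fintype W] (D : Set (K → ℂ)) where
  X : Set (K ⊕ W → ℂ)
  G : Type
  [group : Group G]
  [finite : Finite G]
  act : G → (K ⊕ W → ℂ) → (K ⊕ W → ℂ)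
  act_poly : ∀ g, RealPolyMap (act g)
  act_mem : ∀ g, ∀ φ ∈ X, act g φ ∈ X
  act_one : ∀ φ ∈ X, act 1 φ = φ
  act_mul : ∀ g h, ∀ φ ∈ X, act (g * h) φ = act g (act h φ)
  act_inl : ∀ g, ∀ φ ∈ X, act g φ ∘ Sum.inl = φ ∘ Sum.inl
  transitive : ∀ φ ∈ X, ∀ ψ ∈ X, φ ∘ Sum.inl ∈ D → φ ∘ Sum.inl = ψ ∘ Sum.inl →
    ∃! g, act g φ = ψ
  sec : (K → ℂ) → (K ⊕ W → ℂ)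
  sec_analytic : AnalyticOn ℝ sec D
  sec_mem : ∀ c ∈ D, sec c ∈ X
  sec_inl : ∀ c ∈ D, sec c ∘ Sum.inl = c

namespace PolyCover

attribute [instance] PolyCover.group PolyCover.finite

variable {K W K₂ W₂ : Type} [Fintype K] [Fintype W] [Fintype K₂] [Fintype W₂]
  {D : Set (K → ℂ)} {D₂ : Set (K₂ → ℂ)}

/-- Some coordinate is the function `f` of the base point. -/
def Computes (C : PolyCover K W D) (f : (K → ℂ) → ℂ) : Prop :=
  ∃ v, ∀ φ ∈ C.X, φ v = f (φ ∘ Sum.inl)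

/-- The trivial cover. -/
def base (D : Set (K → ℂ)) : PolyCover K Empty D where
  X := Set.univ
  G := Unit
  act _ φ := φ
  act_poly _ := RealPolyMap.reindex id
  act_mem _ _ _ := trivial
  act_one _ _ := rfl
  act_mul _ _ _ _ := rfl
  act_inl _ _ _ := rfl
  transitive φ _ ψ _ _ h := by
    refine ⟨(), ?_, fun _ _ => rfl⟩
    ext (v | v)
    · exact congrFun h v
    · exact v.elim
  sec c := Sum.elim c Empty.elim
  sec_analytic := RealPolyMap.analyticOn (by rintro (v | v); exacts [RealPoly.proj v, v.elim]) D
  sec_mem _ _ := trivial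
  sec_inl _ _ := rfl

/-- Transport of a cover along an embedding with a polynomial left inverse. -/
def map (C : PolyCover K W D) (Q : (K ⊕ W → ℂ) → (K ⊕ W₂ → ℂ)) (q : (K ⊕ W₂ → ℂ) → (K ⊕ W → ℂ))
    (hQ : RealPolyMap Q) (hq : RealPolyMap q) (hqQ : ∀ φ ∈ C.X, q (Q φ) = φ)
    (hinl : ∀ φ, Q φ ∘ Sum.inl = φ ∘ Sum.inl) : PolyCover K W₂ D where
  X := Q '' C.X
  G := C.G
  act g φ := Q (C.act g (q φ))
  act_poly g := hQ.comp ((C.act_poly g).comp hq)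
  act_mem := by
    rintro g _ ⟨φ, hφ, rfl⟩
    rw [hqQ φ hφ]
    exact ⟨_, C.act_mem g φ hφ, rfl⟩
  act_one := by
    rintro _ ⟨φ, hφ, rfl⟩
    rw [hqQ φ hφ, C.act_one φ hφ]
  act_mul := by
    rintro g h _ ⟨φ, hφ, rfl⟩
    rw [hqQ φ hφ, C.act_mul g h φ hφ, hqQ _ (C.act_mem h φ hφ)]
  act_inl := by
    rintro g _ ⟨φ, hφ, rfl⟩
    rw [hqQ φ hφ, hinl, hinl, C.act_inl g φ hφ]
  transitive := by
    rintro _ ⟨φ, hφ, rfl⟩ _ ⟨ψ, hψ, rfl⟩ hD h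
    rw [hinl] at hD h
    rw [hinl] at h
    obtain ⟨g, hg, hu⟩ := C.transitive φ hφ ψ hψ hD h
    refine ⟨g, ?_, fun g' hg' => hu g' ?_⟩
    · simp only [hqQ φ hφ, hg]
    · have := congrArg q hg'
      simpa only [hqQ φ hφ, hqQ ψ hψ, hqQ _ (C.act_mem g' φ hφ)] using this
  sec c := Q (C.sec c)
  sec_analytic := (hQ.analyticOn Set.univ).comp C.sec_analytic (Set.mapsTo_univ _ _)
  sec_mem c hc := ⟨_, C.sec_mem c hc, rfl⟩
  sec_inl c hc := by rw [hinl, C.sec_inl c hc]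

/-- The coordinates of the first cover among those of a glued cover. -/
def old : K ⊕ W → K ⊕ (W ⊕ W₂) := Sum.map id Sum.inl

/-- The coordinates of the second cover among those of a cover glued along `e`. -/
def new (e : K₂ → K ⊕ W) : K₂ ⊕ W₂ → K ⊕ (W ⊕ W₂) :=
  Sum.elim (fun k => old (e k)) (fun w => Sum.inr (Sum.inr w))

omit [Fintype K] [Fintype W] [Fintype K₂] [Fintype W₂] in
theorem ext_old_new (e : K₂ → K ⊕ W) {φ ψ : K ⊕ (W ⊕ W₂) → ℂ} (h : φ ∘ old = ψ ∘ old)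
    (h' : φ ∘ new e = ψ ∘ new e) : φ = ψ := by
  ext (v | v | v)
  · exact congrFun h (Sum.inl v)
  · exact congrFun h (Sum.inr v)
  · exact congrFun h' (Sum.inr v)

/-- The point of the glued cover with the given coordinates. -/
def glue (φ : K ⊕ W → ℂ) (ψ : K₂ ⊕ W₂ → ℂ) : K ⊕ (W ⊕ W₂) → ℂ :=
  Sum.elim (fun v => φ (Sum.inl v)) (Sum.elim (fun v => φ (Sum.inr v)) (fun v => ψ (Sum.inr v)))

omit [Fintype K] [Fintype W] [Fintype K₂] [Fintype W₂] in
theorem glue_old (φ : K ⊕ W → ℂ) (ψ : K₂ ⊕ W₂ → ℂ) : glue φ ψ ∘ old = φ := by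
  ext (v | v) <;> rfl

omit [Fintype K] [Fintype W] [Fintype K₂] [Fintype W₂] in
theorem glue_new {e : K₂ → K ⊕ W} {φ : K ⊕ W → ℂ} {ψ : K₂ ⊕ W₂ → ℂ}
    (h : φ ∘ e = ψ ∘ Sum.inl) : glue φ ψ ∘ new e = ψ := by
  ext (v | v)
  · refine Eq.trans ?_ (congrFun h v)
    exact congrFun (glue_old φ ψ) (e v)
  · rfl

/-- Two covers glued along coordinates `e` of the first that are the functions `f` of the base
point. -/
def glued (C : PolyCover K W D) (C₂ : PolyCover K₂ W₂ D₂) (e : K₂ → K ⊕ W)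
    (f : K₂ → (K → ℂ) → ℂ) (he : ∀ k, ∀ φ ∈ C.X, φ (e k) = f k (φ ∘ Sum.inl))
    (hD : ∀ c ∈ D, (fun k => f k c) ∈ D₂) : PolyCover K (W ⊕ W₂) D := by
  have he' : ∀ φ ∈ C.X, φ ∘ e = fun k => f k (φ ∘ Sum.inl) := fun φ hφ => by
    ext k
    exact he k φ hφ
  have key : ∀ g h, ∀ φ : K ⊕ (W ⊕ W₂) → ℂ, φ ∘ old ∈ C.X → φ ∘ new e ∈ C₂.X →
      C.act g (φ ∘ old) ∘ e = C₂.act h (φ ∘ new e) ∘ Sum.inl := by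
    intro g h φ h1 h2
    rw [he' _ (C.act_mem g _ h1), C.act_inl g _ h1, C₂.act_inl h _ h2, ← he' _ h1]
    rfl
  have skey : ∀ c ∈ D, C.sec c ∘ e = C₂.sec (fun k => f k c) ∘ Sum.inl := by
    intro c hc
    rw [he' _ (C.sec_mem c hc), C.sec_inl c hc, C₂.sec_inl _ (hD c hc)]
  exact
  { X := {φ | φ ∘ old ∈ C.X ∧ φ ∘ new e ∈ C₂.X}
    G := C.G × C₂.G
    act := fun g φ => glue (C.act g.1 (φ ∘ old)) (C₂.act g.2 (φ ∘ new e))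
    act_poly := by
      rintro g (v | v | v)
      · exact (((C.act_poly g.1).comp (RealPolyMap.reindex old)) _)
      · exact (((C.act_poly g.1).comp (RealPolyMap.reindex old)) _)
      · exact (((C₂.act_poly g.2).comp (RealPolyMap.reindex (new e))) _)
    act_mem := by
      rintro g φ ⟨h1, h2⟩
      refine ⟨?_, ?_⟩
      · rw [glue_old]
        exact C.act_mem _ _ h1
      · rw [glue_new (key _ _ φ h1 h2)]
        exact C₂.act_mem _ _ h2
    act_one := by
      rintro φ ⟨h1, h2⟩
      apply ext_old_new e
      · rw [glue_old]
        exact C.act_one _ h1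
      · rw [glue_new (key _ _ φ h1 h2)]
        exact C₂.act_one _ h2
    act_mul := by
      rintro g h φ ⟨h1, h2⟩
      simp only [glue_old, glue_new (key _ _ φ h1 h2)]
      rw [Prod.fst_mul, Prod.snd_mul, C.act_mul _ _ _ h1, C₂.act_mul _ _ _ h2]
    act_inl := by
      rintro g φ ⟨h1, h2⟩
      exact C.act_inl g.1 _ h1
    transitive := by
      rintro φ ⟨h1, h2⟩ ψ ⟨h3, h4⟩ hφ h
      obtain ⟨g, hg, hgu⟩ := C.transitive _ h1 _ h3 hφ h
      have e1 : (φ ∘ new e) ∘ Sum.inl = fun k => f k (φ ∘ Sum.inl) := he' _ h1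
      have e2 : (ψ ∘ new e) ∘ Sum.inl = fun k => f k (ψ ∘ Sum.inl) := he' _ h3
      obtain ⟨k, hk, hku⟩ := C₂.transitive _ h2 _ h4 (by rw [e1]; exact hD _ hφ)
        (by rw [e1, e2, h])
      refine ⟨(g, k), ?_, ?_⟩
      · apply ext_old_new e
        · rw [glue_old, hg]
        · rw [glue_new (key _ _ φ h1 h2), hk]
      · rintro ⟨g', k'⟩ h'
        rw [← h'] at hgu hku
        rw [glue_old] at hgu
        rw [glue_new (key _ _ φ h1 h2)] at hku
        exact Prod.ext (hgu g' rfl) (hku k' rfl)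
    sec := fun c => glue (C.sec c) (C₂.sec (C.sec c ∘ e))
    sec_analytic := by
      have a1 : AnalyticOn ℝ (fun c => C₂.sec (C.sec c ∘ e)) D :=
        C₂.sec_analytic.comp
          (((RealPolyMap.reindex e).analyticOn Set.univ).comp C.sec_analytic
            (Set.mapsTo_univ _ _))
          (fun c hc => by
            rw [skey c hc, C₂.sec_inl _ (hD c hc)]
            exact hD c hc)
      have a2 := analyticOn_pi_iff.1 a1
      have a3 := analyticOn_pi_iff.1 C.sec_analytic
      refine analyticOn_pi_iff.2 ?_
      rintro (v | v | v)
      · exact a3 _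
      · exact a3 _
      · exact a2 _
    sec_mem := by
      intro c hc
      have e1 : C.sec c ∘ e = fun k => f k c := by rw [skey c hc, C₂.sec_inl _ (hD c hc)]
      refine ⟨?_, ?_⟩
      · rw [glue_old]
        exact C.sec_mem c hc
      · rw [e1, glue_new (skey c hc)]
        exact C₂.sec_mem _ (hD c hc)
    sec_inl := fun c hc => C.sec_inl c hc }

end PolyCover

/-- The functions in `F` are simultaneously computed by a cover over `D` that is a configuration
space. -/
def Realizable {K : Type} [Fintype K] (D : Set (K → ℂ)) (F : Set ((K → ℂ) → ℂ)) : Prop :=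
  ∃ (W : Type) (_ : Fintype W) (C : PolyCover K W D), IsConfig C.X ∧ ∀ f ∈ F, C.Computes f

namespace Realizable

variable {K : Type} [Fintype K] {D : Set (K → ℂ)} {F F' : Set ((K → ℂ) → ℂ)}

theorem mono (h : Realizable D F) (hF : F' ⊆ F) : Realizable D F' := by
  obtain ⟨W, i, C, hC, h⟩ := h
  exact ⟨W, i, C, hC, fun f hf => h f (hF hf)⟩

theorem coordinates (D : Set (K → ℂ)) : Realizable D (Set.range fun k (x : K → ℂ) => x k) := by
  refine ⟨Empty, inferInstance, PolyCover.base D, IsConfig.univ, ?_⟩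
  rintro _ ⟨k, rfl⟩
  exact ⟨Sum.inl k, fun φ _ => rfl⟩

theorem exists_attach {K₂ W₂ : Type} [Fintype K₂] [Fintype W₂] {D₂ : Set (K₂ → ℂ)}
    (h : Realizable D F) (C₂ : PolyCover K₂ W₂ D₂) (hC₂ : IsConfig C₂.X)
    (f : K₂ → (K → ℂ) → ℂ) (hf : ∀ k, f k ∈ F) (hD : ∀ c ∈ D, (fun k => f k c) ∈ D₂) :
    ∃ (W : Type) (_ : Fintype W) (C : PolyCover K W D), IsConfig C.X ∧ (∀ f ∈ F, C.Computes f) ∧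
      (∀ g, C₂.Computes g → C.Computes fun c => g fun k => f k c) ∧
      ∀ φ ∈ C.X, ∃ ψ ∈ C₂.X, ψ ∘ Sum.inl = fun k => f k (φ ∘ Sum.inl) := by
  obtain ⟨W, i, C, hC, h⟩ := h
  choose e he using fun k => h (f k) (hf k)
  have key : ∀ φ ∈ (C.glued C₂ e f he hD).X,
      (φ ∘ PolyCover.new e) ∘ Sum.inl = fun k => f k (φ ∘ Sum.inl) := by
    rintro φ ⟨h1, -⟩
    ext k
    exact he k _ h1
  refine ⟨W ⊕ W₂, inferInstance, C.glued C₂ e f he hD,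
    (hC.reindex PolyCover.old).and (hC₂.reindex (PolyCover.new e)), ?_, ?_, ?_⟩
  · intro f' hf'
    obtain ⟨v, hv⟩ := h f' hf'
    exact ⟨PolyCover.old v, fun φ hφ => hv _ hφ.1⟩
  · rintro g ⟨v, hv⟩
    exact ⟨PolyCover.new e v, fun φ hφ => (hv _ hφ.2).trans (congrArg g (key φ hφ))⟩
  · exact fun φ hφ => ⟨_, hφ.2, key φ hφ⟩

theorem attach {K₂ W₂ : Type} [Fintype K₂] [Fintype W₂] {D₂ : Set (K₂ → ℂ)}
    (h : Realizable D F) (C₂ : PolyCover K₂ W₂ D₂) (hC₂ : IsConfig C₂.X) {g : (K₂ → ℂ) → ℂ}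
    (hg : C₂.Computes g) (f : K₂ → (K → ℂ) → ℂ) (hf : ∀ k, f k ∈ F)
    (hD : ∀ c ∈ D, (fun k => f k c) ∈ D₂) :
    Realizable D (insert (fun c => g fun k => f k c) F) := by
  obtain ⟨W, i, C, hC, h1, h2, -⟩ := h.exists_attach C₂ hC₂ f hf hD
  refine ⟨W, i, C, hC, ?_⟩
  rintro f' (rfl | hf')
  exacts [h2 g hg, h1 f' hf']

end Realizable

namespace PolyCover

variable {K W : Type} [Fintype K] [Fintype W] {D : Set (K → ℂ)}

/-- The part of a cover over a subset of the base. -/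
def restrict (C : PolyCover K W D) (Y : Set (K → ℂ)) (hD : D ⊆ Y) : PolyCover K W D where
  X := {φ | φ ∈ C.X ∧ φ ∘ Sum.inl ∈ Y}
  G := C.G
  act := C.act
  act_poly := C.act_poly
  act_mem g φ h := ⟨C.act_mem g φ h.1, by rw [C.act_inl g φ h.1]; exact h.2⟩
  act_one φ h := C.act_one φ h.1
  act_mul g k φ h := C.act_mul g k φ h.1
  act_inl g φ h := C.act_inl g φ h.1
  transitive φ h ψ h' := C.transitive φ h.1 ψ h'.1
  sec := C.sec
  sec_analytic := C.sec_analytic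
  sec_mem c hc := ⟨C.sec_mem c hc, by rw [C.sec_inl c hc]; exact hD hc⟩
  sec_inl := C.sec_inl

/-- The action of the covering group as permutations. -/
def toPerm (C : PolyCover K W D) : C.G →* Equiv.Perm C.X where
  toFun g :=
    { toFun := fun φ => ⟨C.act g φ, C.act_mem g φ φ.2⟩
      invFun := fun φ => ⟨C.act g⁻¹ φ, C.act_mem g⁻¹ φ φ.2⟩
      left_inv := fun φ => Subtype.ext <| by
        change C.act g⁻¹ (C.act g φ) = φ
        rw [← C.act_mul _ _ _ φ.2, inv_mul_cancel, C.act_one _ φ.2]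
      right_inv := fun φ => Subtype.ext <| by
        change C.act g (C.act g⁻¹ φ) = φ
        rw [← C.act_mul _ _ _ φ.2, mul_inv_cancel, C.act_one _ φ.2] }
  map_one' := Equiv.ext fun φ => Subtype.ext (C.act_one _ φ.2)
  map_mul' g h := Equiv.ext fun φ => Subtype.ext (C.act_mul g h _ φ.2)

/-- The section over the base obtained from the standard one by a covering transformation. -/
def translatedSec (C : PolyCover K W D) (g : C.G) (c : K → ℂ) : K ⊕ W → ℂ := C.act g (C.sec c)

theorem translatedSec_mem (C : PolyCover K W D) (g : C.G) {c : K → ℂ} (hc : c ∈ D) :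
    C.translatedSec g c ∈ C.X :=
  C.act_mem g _ (C.sec_mem c hc)

theorem translatedSec_inl (C : PolyCover K W D) (g : C.G) {c : K → ℂ} (hc : c ∈ D) :
    C.translatedSec g c ∘ Sum.inl = c := by
  rw [translatedSec, C.act_inl g _ (C.sec_mem c hc), C.sec_inl c hc]

theorem translatedSec_analytic (C : PolyCover K W D) (g : C.G) : AnalyticOn ℝ (C.translatedSec g) D :=
  ((C.act_poly g).analyticOn Set.univ).comp C.sec_analytic (Set.mapsTo_univ _ _)

theorem existsUnique_translatedSec (C : PolyCover K W D) {φ : K ⊕ W → ℂ} (hφ : φ ∈ C.X)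
    (hD : φ ∘ Sum.inl ∈ D) : ∃! g, C.translatedSec g (φ ∘ Sum.inl) = φ :=
  C.transitive _ (C.sec_mem _ hD) φ hφ (by rwa [C.sec_inl _ hD]) (C.sec_inl _ hD)

/-- The sheet through a section. -/
def sheet (C : PolyCover K W D) (g : C.G) : Set (K ⊕ W → ℂ) := C.translatedSec g '' D

theorem mem_sheet_iff (C : PolyCover K W D) (g : C.G) {φ : K ⊕ W → ℂ} (hD : φ ∘ Sum.inl ∈ D) :
    φ ∈ C.sheet g ↔ C.translatedSec g (φ ∘ Sum.inl) = φ := by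
  constructor
  · rintro ⟨c, hc, rfl⟩
    rw [C.translatedSec_inl g hc]
  · exact fun h => ⟨_, hD, h⟩

theorem analyticOn_inl (s : Set (K ⊕ W → ℂ)) :
    AnalyticOn ℝ (fun φ : K ⊕ W → ℂ => φ ∘ Sum.inl) s :=
  (RealPolyMap.reindex Sum.inl).analyticOn s

theorem isAnalyticIsoOn_translatedSec (C : PolyCover K W D) (g : C.G) {A : Set (K ⊕ W → ℂ)}
    {B : Set (K → ℂ)} (hB : B ⊆ D) (h1 : Set.MapsTo (fun φ => φ ∘ Sum.inl) A B)
    (h2 : Set.MapsTo (C.translatedSec g) B A) (h3 : A ⊆ C.sheet g) :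
    IsAnalyticIsoOn (fun φ : K ⊕ W → ℂ => φ ∘ Sum.inl) A B :=
  ⟨h1, analyticOn_inl A, C.translatedSec g, h2, (C.translatedSec_analytic g).mono hB,
    fun _ hφ => (C.mem_sheet_iff g (hB (h1 hφ))).1 (h3 hφ),
    fun _ hc => C.translatedSec_inl g (hB hc)⟩

theorem exists_isOpen_sheet (C : PolyCover K W D) (g : C.G) :
    ∃ O, IsOpen O ∧
      C.sheet g = (C.X ∩ (fun φ : K ⊕ W → ℂ => φ ∘ Sum.inl) ⁻¹' D) ∩ O := by
  set A := C.X ∩ (fun φ : K ⊕ W → ℂ => φ ∘ Sum.inl) ⁻¹' D with hA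
  have hcl : ∀ h : C.G, IsClosed {a : A | C.translatedSec h (a.1 ∘ Sum.inl) = a.1} := by
    intro h
    refine isClosed_eq ?_ continuous_subtype_val
    have hc : ContinuousOn (C.translatedSec h) D := (C.translatedSec_analytic h).continuousOn
    exact hc.comp_continuous
      ((continuous_pi fun k => continuous_apply (Sum.inl k)).comp continuous_subtype_val)
      fun a => a.2.2
  have hopen : IsOpen {a : A | C.translatedSec g (a.1 ∘ Sum.inl) = a.1} := by
    have : {a : A | C.translatedSec g (a.1 ∘ Sum.inl) = a.1} =
        (⋃ h ∈ {h : C.G | h ≠ g}, {a : A | C.translatedSec h (a.1 ∘ Sum.inl) = a.1})ᶜ := by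
      ext a
      obtain ⟨k, hk, hu⟩ := C.existsUnique_translatedSec a.2.1 a.2.2
      simp only [Set.mem_compl_iff, Set.mem_iUnion, Set.mem_ofPred_eq, not_exists]
      constructor
      · intro h h' hne h''
        exact hne ((hu h' h'').trans (hu g h).symm)
      · intro h
        by_contra hg
        exact h k (fun e => hg (e ▸ hk)) hk
    rw [this, isOpen_compl_iff]
    exact (Set.toFinite _).isClosed_biUnion fun h _ => hcl h
  obtain ⟨O, hO, e⟩ := isOpen_induced_iff.1 hopen
  refine ⟨O, hO, ?_⟩
  ext φ
  constructor
  · rintro ⟨c, hc, rfl⟩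
    have hmem : C.translatedSec g c ∈ A :=
      ⟨C.translatedSec_mem g hc, by rw [Set.mem_preimage, C.translatedSec_inl g hc]; exact hc⟩
    refine ⟨hmem, ?_⟩
    have : (⟨_, hmem⟩ : A) ∈ Subtype.val ⁻¹' O := by
      rw [e]
      change C.translatedSec g (C.translatedSec g c ∘ Sum.inl) = C.translatedSec g c
      rw [C.translatedSec_inl g hc]
    exact this
  · rintro ⟨hφ, hO'⟩
    have : (⟨φ, hφ⟩ : A) ∈ Subtype.val ⁻¹' O := hO'
    rw [e] at this
    exact (C.mem_sheet_iff g hφ.2).2 this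

theorem iUnion_sheet (C : PolyCover K W D) :
    C.X ∩ (fun φ : K ⊕ W → ℂ => φ ∘ Sum.inl) ⁻¹' D = ⋃ g, C.sheet g := by
  ext φ
  simp only [Set.mem_iUnion]
  constructor
  · rintro ⟨h, h'⟩
    obtain ⟨g, hg, -⟩ := C.existsUnique_translatedSec h h'
    exact ⟨g, (C.mem_sheet_iff g h').2 hg⟩
  · rintro ⟨g, c, hc, rfl⟩
    exact ⟨C.translatedSec_mem g hc, by rw [Set.mem_preimage, C.translatedSec_inl g hc]; exact hc⟩

theorem disjoint_sheet (C : PolyCover K W D) {g h : C.G} (hgh : g ≠ h) :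
    Disjoint (C.sheet g) (C.sheet h) := by
  rw [Set.disjoint_left]
  rintro _ ⟨c, hc, rfl⟩ h2
  have h0 := C.translatedSec_inl g hc
  rw [C.mem_sheet_iff h (by rw [h0]; exact hc)] at h2
  exact hgh ((C.existsUnique_translatedSec (C.translatedSec_mem g hc) (by rw [h0]; exact hc)).unique
    (by rw [h0]) h2)

theorem connectedComponentIn_subset_sheet (C : PolyCover K W D) {g : C.G} {φ : K ⊕ W → ℂ}
    (hφ : φ ∈ C.sheet g) :
    connectedComponentIn (C.X ∩ (fun φ : K ⊕ W → ℂ => φ ∘ Sum.inl) ⁻¹' D) φ ⊆ C.sheet g := by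
  choose O hO hs using C.exists_isOpen_sheet
  intro ψ hψ
  have hsub := connectedComponentIn_subset
    (C.X ∩ (fun φ : K ⊕ W → ℂ => φ ∘ Sum.inl) ⁻¹' D) φ
  have hφA : φ ∈ C.X ∩ (fun φ : K ⊕ W → ℂ => φ ∘ Sum.inl) ⁻¹' D := by
    rw [C.iUnion_sheet]
    exact Set.mem_iUnion.2 ⟨g, hφ⟩
  by_contra hne
  have hmem := hsub hψ
  rw [C.iUnion_sheet, Set.mem_iUnion] at hmem
  obtain ⟨k, hk⟩ := hmem
  have hkg : k ≠ g := fun e => hne (e ▸ hk)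
  obtain ⟨χ, hχ, h1, h2⟩ := isPreconnected_connectedComponentIn (O g) (⋃ h ∈ {h | h ≠ g}, O h)
    (hO g) (isOpen_biUnion fun h _ => hO h)
    (fun χ hχ => by
      have hm := hsub hχ
      rw [C.iUnion_sheet, Set.mem_iUnion] at hm
      obtain ⟨h, hh⟩ := hm
      rw [hs h] at hh
      by_cases e : h = g
      · exact Or.inl (e ▸ hh.2)
      · exact Or.inr (Set.mem_biUnion (x := h) e hh.2))
    ⟨φ, mem_connectedComponentIn hφA, by rw [hs g] at hφ; exact hφ.2⟩
    ⟨ψ, hψ, Set.mem_biUnion (x := k) hkg (by rw [hs k] at hk; exact hk.2)⟩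
  rw [Set.mem_iUnion₂] at h2
  obtain ⟨h, hh, hχO⟩ := h2
  refine (Set.disjoint_left.1 (C.disjoint_sheet hh)) (a := χ) ?_ ?_
  · rw [hs h]
    exact ⟨hsub hχ, hχO⟩
  · rw [hs g]
    exact ⟨hsub hχ, h1⟩

theorem isAnalyticallyTrivialCovering (C : PolyCover K W D) :
    IsAnalyticallyTrivialCovering (fun φ : K ⊕ W → ℂ => φ ∘ Sum.inl)
      (C.X ∩ (fun φ : K ⊕ W → ℂ => φ ∘ Sum.inl) ⁻¹' D) D where
  sheets := by
    obtain ⟨n, ⟨e⟩⟩ := Finite.exists_equiv_fin C.G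
    refine ⟨n, fun i => C.sheet (e.symm i), ?_, ?_, ?_, ?_⟩
    · rw [C.iUnion_sheet]
      exact (e.symm.surjective.iUnion_comp _).symm
    · exact fun i j hij => C.disjoint_sheet fun h => hij (e.symm.injective h)
    · exact fun i => C.exists_isOpen_sheet _
    · intro i
      refine C.isAnalyticIsoOn_translatedSec (e.symm i) subset_rfl ?_ (Set.mapsTo_image _ _) subset_rfl
      rintro _ ⟨c, hc, rfl⟩
      change C.translatedSec _ c ∘ Sum.inl ∈ D
      rw [C.translatedSec_inl _ hc]
      exact hc
  components := by
    intro φ hφ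
    obtain ⟨g, hg, -⟩ := C.existsUnique_translatedSec hφ.1 hφ.2
    have hsub := connectedComponentIn_subset D (φ ∘ Sum.inl)
    refine C.isAnalyticIsoOn_translatedSec g hsub ?_ ?_
      (C.connectedComponentIn_subset_sheet ((C.mem_sheet_iff g hφ.2).2 hg))
    · refine Set.mapsTo_iff_image_subset.2 (IsPreconnected.subset_connectedComponentIn
        (isPreconnected_connectedComponentIn.image _ (analyticOn_inl _).continuousOn)
        ⟨φ, mem_connectedComponentIn hφ, rfl⟩ ?_)
      rintro _ ⟨ψ, hψ, rfl⟩
      exact (connectedComponentIn_subset _ _ hψ).2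
    · refine Set.mapsTo_iff_image_subset.2 (IsPreconnected.subset_connectedComponentIn
        (isPreconnected_connectedComponentIn.image _
          ((C.translatedSec_analytic g).continuousOn.mono hsub))
        ⟨_, mem_connectedComponentIn hφ.2, hg⟩ ?_)
      rintro _ ⟨c, hc, rfl⟩
      rw [C.iUnion_sheet]
      exact Set.mem_iUnion.2 ⟨g, c, hsub hc, rfl⟩

theorem isAnalyticallyTrivialPolynomialCoveringOver (C : PolyCover K W D) {S : Set (K → ℂ)}
    (hS : ∀ φ ∈ C.X, φ ∘ Sum.inl ∈ S) :
    IsAnalyticallyTrivialPolynomialCoveringOver (fun φ : K ⊕ W → ℂ => φ ∘ Sum.inl) C.X S D where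
  mapsTo := hS
  polynomial := (RealPolyMap.reindex Sum.inl).isRealPolynomialMap C.X
  trivial := C.isAnalyticallyTrivialCovering
  surj u hu := ⟨C.sec u, C.sec_mem u hu, C.sec_inl u hu⟩
  regular := by
    refine ⟨C.toPerm.range, Set.finite_range C.toPerm, ?_, ?_, ?_⟩
    · rintro _ ⟨g, rfl⟩
      exact (C.act_poly g).isRealPolynomialMap C.X
    · rintro _ ⟨g, rfl⟩ φ
      exact C.act_inl g φ φ.2
    · intro φ ψ hφ h
      obtain ⟨g, hg, hu⟩ := C.transitive φ φ.2 ψ ψ.2 hφ h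
      refine ⟨C.toPerm g, ⟨⟨g, rfl⟩, Subtype.ext hg⟩, ?_⟩
      rintro _ ⟨⟨k, rfl⟩, hk⟩
      rw [hu k (congrArg Subtype.val hk)]

end PolyCover

theorem Complex.norm_sub_one_eq_one_and_norm_add_one_eq_one {z : ℂ} :
    ‖z - 1‖ = 1 ∧ ‖z - -1‖ = 1 ↔ z = 0 := by
  constructor
  · rintro ⟨h1, h2⟩
    have h := parallelogram_law_with_norm ℝ z 1
    rw [sub_neg_eq_add] at h2
    rw [h1, h2, norm_one] at h
    rw [← norm_eq_zero, ← sq_eq_zero_iff]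
    linarith
  · rintro rfl
    simp

theorem Realizable.exists_covering {m : ℕ} {D : Set (Fin m → ℂ)}
    {F : Set ((Fin m → ℂ) → ℂ)} (h : Realizable D F) (hne : D.Nonempty)
    {T : Set ((Fin m → ℂ) → ℂ)} (hT : T ⊆ F) (h1 : (fun _ => 1) ∈ F) (h2 : (fun _ => -1) ∈ F)
    (hD : ∀ f ∈ T, ∀ c ∈ D, f c = 0) :
    ∃ (V : Type) (_ : Fintype V) (L : MarkedLinkage V) (Z : Fin L.numFixed → ℂ) (P : Fin m ↪ V),
      IsAnalyticallyTrivialPolynomialCoveringOver (inputMap P) (L.configSpace Z)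
        {c | ∀ f ∈ T, f c = 0} D := by
  obtain ⟨W, _, C, hC, h⟩ := h
  obtain ⟨a, ha⟩ := h _ h1
  obtain ⟨b, hb⟩ := h _ h2
  choose v hv using fun f : T => h f (hT f.2)
  let C' := C.restrict {c | ∀ f ∈ T, f c = 0} fun c hc f hf => hD f hf c hc
  have hC' : IsConfig C'.X := by
    have e : C'.X = C.X ∩ ⋂ f : T, {φ | ‖φ (v f) - φ a‖ = 1 ∧ ‖φ (v f) - φ b‖ = 1} := by
      ext φ
      simp only [Set.mem_inter_iff, Set.mem_iInter, Set.mem_ofPred_eq]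
      refine and_congr_right fun hφ => ?_
      rw [ha φ hφ, hb φ hφ]
      simp only [Complex.norm_sub_one_eq_one_and_norm_add_one_eq_one, Subtype.forall]
      refine forall₂_congr fun f hf => ?_
      rw [hv ⟨f, hf⟩ φ hφ]
    rw [e]
    exact hC.inter (IsConfig.iInter fun f =>
      (IsConfig.dist _ _ one_pos).and (IsConfig.dist _ _ one_pos))
  obtain ⟨c, hc⟩ := hne
  obtain ⟨L, Z, hL⟩ := hC'.exists_linkage ⟨_, C'.sec_mem c hc⟩
  refine ⟨Fin m ⊕ W, inferInstance, L, Z, Function.Embedding.inl, ?_⟩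
  rw [hL]
  exact C'.isAnalyticallyTrivialPolynomialCoveringOver fun φ hφ => hφ.2

/-- A linkage without realizations covers the empty set. -/
theorem exists_covering_empty {m : ℕ} (S : Set (Fin m → ℂ)) :
    ∃ (V : Type) (_ : Fintype V) (L : MarkedLinkage V) (Z : Fin L.numFixed → ℂ) (P : Fin m ↪ V),
      IsAnalyticallyTrivialPolynomialCoveringOver (inputMap P) (L.configSpace Z) S ∅ := by
  let L : MarkedLinkage (Fin m ⊕ Bool) :=
    { graph := ⊤
      length := fun _ => 1
      length_pos := fun _ => one_pos
      numFixed := 2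
      fixed := finTwoEquiv.toEmbedding.trans Function.Embedding.inr }
  have hL : L.configSpace 0 = ∅ := by
    refine Set.eq_empty_of_forall_notMem ?_
    rintro φ ⟨hr, hf⟩
    have h := hr (Sum.inr false) (Sum.inr true) (by simp [L])
    have h0 : φ (Sum.inr false) = 0 := hf (0 : Fin 2)
    have h1 : φ (Sum.inr true) = 0 := hf (1 : Fin 2)
    rw [h0, h1] at h
    simp [L] at h
  refine ⟨_, inferInstance, L, 0, Function.Embedding.inl, ?_⟩
  rw [hL]
  refine ⟨Set.mapsTo_empty _ _, ⟨fun _ => 0, fun x => x.2.elim⟩, ⟨?_, ?_⟩, ?_, ?_⟩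
  · exact ⟨0, Fin.elim0, by simp, fun i => i.elim0, fun i => i.elim0, fun i => i.elim0⟩
  · exact fun x hx => hx.1.elim
  · exact fun u hu => hu.elim
  · refine ⟨⊥, inferInstance, ?_, ?_, fun x => x.2.elim⟩
    · exact fun σ _ => ⟨fun _ => 0, fun x => x.2.elim⟩
    · exact fun σ _ x => x.2.elim

section PlaneGeometry

theorem Complex.norm_eq_iff_sq {z : ℂ} {r : ℝ} (hr : 0 ≤ r) :
    ‖z‖ = r ↔ z.re ^ 2 + z.im ^ 2 = r ^ 2 := by
  rw [← sq_eq_sq₀ (norm_nonneg z) hr, ← Complex.normSq_eq_norm_sq, Complex.normSq_apply]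
  simp only [sq]

theorem Complex.eq_zero_of_sq_add_sq {z : ℂ} (h : z.re ^ 2 + z.im ^ 2 = 0) : z = 0 :=
  Complex.ext (by simpa using (by nlinarith [sq_nonneg z.re, sq_nonneg z.im] : z.re ^ 2 = 0))
    (by simpa using (by nlinarith [sq_nonneg z.re, sq_nonneg z.im] : z.im ^ 2 = 0))

/-- A point whose distances to the endpoints of a bar are those of a point of the line through the
bar is this point. -/
theorem eq_of_dist_bar {a x m : ℂ} {r t : ℝ} (hr : 0 ≤ r) (h : ‖x - a‖ = r)
    (h1 : ‖m - a‖ = |t| * r) (h2 : ‖m - x‖ = |1 - t| * r) : m = a + t * (x - a) := by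
  rw [Complex.norm_eq_iff_sq (by positivity)] at h h1 h2
  rw [mul_pow, sq_abs] at h1 h2
  simp only [Complex.sub_re, Complex.sub_im] at h h1 h2
  refine sub_eq_zero.1 (Complex.eq_zero_of_sq_add_sq ?_)
  simp only [Complex.sub_re, Complex.sub_im, Complex.add_re, Complex.add_im, Complex.re_ofReal_mul,
    Complex.im_ofReal_mul]
  linear_combination (1 - t) * h1 + t * h2 + (t ^ 2 - t) * h

theorem eq_midpoint_of_dist {a x m : ℂ} {r : ℝ} (hr : 0 ≤ r) (h : ‖x - a‖ = r)
    (h1 : ‖m - a‖ = r / 2) (h2 : ‖m - x‖ = r / 2) : m = (a + x) / 2 := by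
  have := eq_of_dist_bar (t := 1 / 2) hr h (by rw [h1, abs_of_pos (by norm_num)]; ring)
    (by rw [h2, abs_of_pos (by norm_num)]; ring)
  rw [this]
  push_cast
  ring

theorem eq_of_norm_half_add {a b : ℂ} {r : ℝ} (ha : ‖a‖ = r) (hb : ‖b‖ = r)
    (h : ‖(a + b) / 2‖ = r) : a = b := by
  have hr : 0 ≤ r := ha ▸ norm_nonneg a
  have h' : ‖a + b‖ = 2 * r := by
    rw [norm_div, Complex.norm_ofNat] at h
    linarith
  rw [Complex.norm_eq_iff_sq (by positivity)] at ha hb h'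
  simp only [Complex.add_re, Complex.add_im] at h'
  refine sub_eq_zero.1 (Complex.eq_zero_of_sq_add_sq ?_)
  simp only [Complex.sub_re, Complex.sub_im]
  linear_combination 2 * ha + 2 * hb - h'

/-- The vertices of a rhombus on a given diagonal. -/
theorem eq_or_eq_neg_of_norm {s y y' : ℂ} {r : ℝ} (hs : s ≠ 0) (h1 : ‖s + y‖ = r)
    (h2 : ‖s - y‖ = r) (h1' : ‖s + y'‖ = r) (h2' : ‖s - y'‖ = r) : y' = y ∨ y' = -y := by
  have hr : 0 ≤ r := h1 ▸ norm_nonneg _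
  rw [Complex.norm_eq_iff_sq hr] at h1 h2 h1' h2'
  simp only [Complex.sub_re, Complex.sub_im, Complex.add_re, Complex.add_im] at h1 h2 h1' h2'
  have hp : s.re * y.re + s.im * y.im = 0 := by linarith
  have hp' : s.re * y'.re + s.im * y'.im = 0 := by linarith
  have hn : y.re ^ 2 + y.im ^ 2 = y'.re ^ 2 + y'.im ^ 2 := by linarith
  rw [← sq_eq_sq_iff_eq_or_eq_neg]
  have key : ∀ w : ℂ, s.re * w.re + s.im * w.im = 0 →
      w ^ 2 * (starRingEnd ℂ) s = -((w.re ^ 2 + w.im ^ 2 : ℝ) : ℂ) * s := by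
    intro w hw
    apply Complex.ext <;> simp [sq]
    · linear_combination 2 * w.re * hw
    · linear_combination 2 * w.im * hw
  refine mul_right_cancel₀ ((map_ne_zero (starRingEnd ℂ)).2 hs) ?_
  rw [key y hp, key y' hp', hn]

theorem norm_unit_mul_rhombus {s y : ℂ} {r : ℝ} (ε : ℤˣ) (h1 : ‖s + y‖ = r) (h2 : ‖s - y‖ = r) :
    ‖s + (ε : ℤ) * y‖ = r ∧ ‖s - (ε : ℤ) * y‖ = r := by
  rcases Int.units_eq_one_or ε with rfl | rfl
  · simpa using ⟨h1, h2⟩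
  · simpa [← sub_eq_add_neg] using ⟨h2, h1⟩

theorem existsUnique_unit_mul {s y y' : ℂ} {r : ℝ} (hs : s ≠ 0) (hsr : ‖s‖ < r)
    (h1 : ‖s + y‖ = r) (h2 : ‖s - y‖ = r) (h1' : ‖s + y'‖ = r) (h2' : ‖s - y'‖ = r) :
    ∃! ε : ℤˣ, ((ε : ℤ) : ℂ) * y = y' := by
  have hy : y ≠ 0 := by
    rintro rfl
    rw [add_zero] at h1
    exact hsr.ne h1
  have huniq : ∀ ε δ : ℤˣ, ((ε : ℤ) : ℂ) * y = ((δ : ℤ) : ℂ) * y → ε = δ := by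
    intro ε δ h
    exact Units.ext (Int.cast_injective (mul_right_cancel₀ hy h))
  rcases eq_or_eq_neg_of_norm hs h1 h2 h1' h2' with rfl | rfl
  · exact ⟨1, by simp, fun ε h => huniq _ _ (by simpa using h)⟩
  · exact ⟨-1, by simp, fun ε h => huniq _ _ (by simpa using h)⟩

/-- The point at height `√(r ^ 2 - ‖s‖ ^ 2)` over the diagonal `s` of a rhombus with sides `r`. -/
theorem norm_I_mul_sqrt {s w : ℂ} {l r : ℝ} (hs : s = l * w) (hw : w ≠ 0) (hr : 0 ≤ r)
    (h : ‖s‖ ≤ r) :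
    ‖s + Complex.I * w * (√(r ^ 2 / (w.re ^ 2 + w.im ^ 2) - l ^ 2) : ℝ)‖ = r ∧
      ‖s - Complex.I * w * (√(r ^ 2 / (w.re ^ 2 + w.im ^ 2) - l ^ 2) : ℝ)‖ = r := by
  have hq : 0 < w.re ^ 2 + w.im ^ 2 := by
    rw [sq, sq, ← Complex.normSq_apply]
    exact Complex.normSq_pos.2 hw
  have hs2 : (l ^ 2) * (w.re ^ 2 + w.im ^ 2) ≤ r ^ 2 := by
    have h2 : ‖s‖ ^ 2 ≤ r ^ 2 := pow_le_pow_left₀ (norm_nonneg _) h 2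
    rw [← Complex.normSq_eq_norm_sq, Complex.normSq_apply, hs, Complex.re_ofReal_mul,
      Complex.im_ofReal_mul] at h2
    linarith
  have hnn : 0 ≤ r ^ 2 / (w.re ^ 2 + w.im ^ 2) - l ^ 2 := by
    rw [sub_nonneg, le_div_iff₀ hq]
    exact hs2
  have hsq := Real.sq_sqrt hnn
  set b := √(r ^ 2 / (w.re ^ 2 + w.im ^ 2) - l ^ 2)
  have hb : b ^ 2 * (w.re ^ 2 + w.im ^ 2) = r ^ 2 - l ^ 2 * (w.re ^ 2 + w.im ^ 2) := by
    rw [hsq]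
    field_simp
  rw [Complex.norm_eq_iff_sq hr, Complex.norm_eq_iff_sq hr, hs]
  constructor <;> simp <;> linear_combination hb

end PlaneGeometry

section Analytic

variable {E : Type} [NormedAddCommGroup E] [NormedSpace ℝ E] {s : Set E}

theorem AnalyticOn.real_sqrt {f : E → ℝ} (hf : AnalyticOn ℝ f s) (h : ∀ x ∈ s, 0 < f x) :
    AnalyticOn ℝ (fun x => √(f x)) s := by
  have h0 : AnalyticOn ℝ (fun x => Real.log (f x)) s := analyticOnNhd_log.analyticOn.comp hf h
  have h1 : AnalyticOn ℝ (fun x => Real.exp (Real.log (f x) * 2⁻¹)) s :=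
    (h0.mul analyticOn_const).rexp
  refine h1.congr fun x hx => ?_
  rw [Real.sqrt_eq_rpow, Real.rpow_def_of_pos (h x hx), one_div]

theorem AnalyticOn.ofReal {f : E → ℝ} (hf : AnalyticOn ℝ f s) :
    AnalyticOn ℝ (fun x => (f x : ℂ)) s :=
  (Complex.ofRealCLM.analyticOn Set.univ).comp hf (Set.mapsTo_univ _ _)

theorem AnalyticOn.re_sq_add_im_sq {f : E → ℂ} (hf : AnalyticOn ℝ f s) :
    AnalyticOn ℝ (fun x => (f x).re ^ 2 + (f x).im ^ 2) s :=
  (((Complex.reCLM.analyticOn Set.univ).comp hf (Set.mapsTo_univ _ _)).pow 2).add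
    (((Complex.imCLM.analyticOn Set.univ).comp hf (Set.mapsTo_univ _ _)).pow 2)

theorem analyticOn_I_mul_sqrt {l : E → ℝ} {w : E → ℂ} {r : ℝ} (hl : AnalyticOn ℝ l s)
    (hw : AnalyticOn ℝ w s) (hw0 : ∀ x ∈ s, w x ≠ 0) (h : ∀ x ∈ s, ‖(l x : ℂ) * w x‖ < r) :
    AnalyticOn ℝ (fun x =>
      Complex.I * w x * (√(r ^ 2 / ((w x).re ^ 2 + (w x).im ^ 2) - l x ^ 2) : ℝ)) s := by
  have hq : ∀ x ∈ s, 0 < (w x).re ^ 2 + (w x).im ^ 2 := by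
    intro x hx
    rw [sq, sq, ← Complex.normSq_apply]
    exact Complex.normSq_pos.2 (hw0 x hx)
  refine (analyticOn_const.mul hw).mul (AnalyticOn.ofReal (AnalyticOn.real_sqrt ?_ ?_))
  · exact (analyticOn_const.div hw.re_sq_add_im_sq fun x hx => (hq x hx).ne').sub (hl.pow 2)
  · intro x hx
    rw [sub_pos, lt_div_iff₀ (hq x hx)]
    have h2 := pow_lt_pow_left₀ (h x hx) (norm_nonneg _) two_ne_zero
    rw [← Complex.normSq_eq_norm_sq, Complex.normSq_apply, Complex.re_ofReal_mul,
      Complex.im_ofReal_mul] at h2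
    linarith

end Analytic

namespace Realizable

variable {K : Type} [Fintype K] {D : Set (K → ℂ)} {F : Set ((K → ℂ) → ℂ)}

theorem const (h : Realizable D F) (c : ℂ) : Realizable D (insert (fun _ => c) F) := by
  let C : PolyCover Empty Unit Set.univ :=
    { X := {φ | φ (Sum.inr ()) = c}
      G := Unit
      act := fun _ φ => φ
      act_poly := fun _ => RealPolyMap.reindex id
      act_mem := fun _ _ h => h
      act_one := fun _ _ => rfl
      act_mul := fun _ _ _ _ => rfl
      act_inl := fun _ _ _ => rfl
      transitive := fun φ h ψ h' _ _ => by
        refine ⟨(), ?_, fun _ _ => rfl⟩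
        ext (v | v)
        · exact v.elim
        · exact Eq.trans h (Eq.symm h')
      sec := fun _ _ => c
      sec_analytic := analyticOn_const
      sec_mem := fun _ _ => rfl
      sec_inl := fun _ _ => Subsingleton.elim _ _ }
  exact h.attach C (IsConfig.fixed _ c) (g := fun _ => c) ⟨Sum.inr (), fun φ h => h⟩
    (fun k => k.elim) (fun k => k.elim) (fun _ _ => trivial)

end Realizable

namespace PolyCover

/-- The apex of an isosceles triangle with legs `r` over a variable base. -/
noncomputable def apex (r : ℝ) :
    PolyCover (Fin 2) Unit {c | c 0 ≠ c 1 ∧ ‖(c 0 - c 1) / 2‖ < r} where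
  X := {φ | ‖φ (.inr ()) - φ (.inl 0)‖ = r ∧ ‖φ (.inr ()) - φ (.inl 1)‖ = r}
  G := ℤˣ
  act ε φ := Sum.elim (φ ∘ Sum.inl) fun _ => (φ (.inl 0) + φ (.inl 1)) / 2 +
    (ε : ℤ) * (φ (.inr ()) - (φ (.inl 0) + φ (.inl 1)) / 2)
  act_poly ε := by
    rintro (j | j)
    · exact RealPoly.proj _
    · have h : RealPoly fun φ : Fin 2 ⊕ Unit → ℂ => (φ (.inl 0) + φ (.inl 1)) / 2 :=
        ((RealPoly.proj _).add (RealPoly.proj _)).div_const 2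
      exact h.add (((RealPoly.proj _).sub h).const_mul _)
  act_mem := by
    rintro ε φ ⟨h1, h2⟩
    have := norm_unit_mul_rhombus (s := (φ (.inl 1) - φ (.inl 0)) / 2)
      (y := φ (.inr ()) - (φ (.inl 0) + φ (.inl 1)) / 2) (r := r) ε
      (by rw [← h1]; congr 1; ring) (by rw [← h2, ← norm_neg]; congr 1; ring)
    constructor
    · rw [← this.1]
      simp only [Sum.elim_inl, Sum.elim_inr, Function.comp_apply]
      congr 1
      ring
    · rw [← this.2, ← norm_neg]
      simp only [Sum.elim_inl, Sum.elim_inr, Function.comp_apply]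
      congr 1
      ring
  act_one φ _ := by
    ext (v | v)
    · rfl
    · simp
  act_mul ε δ φ _ := by
    ext (v | v)
    · rfl
    · simp
      ring
  act_inl _ _ _ := rfl
  transitive := by
    rintro φ ⟨h1, h2⟩ ψ ⟨h3, h4⟩ ⟨hD, hD'⟩ h
    have e0 : φ (.inl 0) = ψ (.inl 0) := congrFun h 0
    have e1 : φ (.inl 1) = ψ (.inl 1) := congrFun h 1
    rw [← e0] at h3
    rw [← e1] at h4
    simp only [Function.comp_apply] at hD hD'
    obtain ⟨ε, hε, hu⟩ := existsUnique_unit_mul (s := (φ (.inl 1) - φ (.inl 0)) / 2)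
      (y := φ (.inr ()) - (φ (.inl 0) + φ (.inl 1)) / 2)
      (y' := ψ (.inr ()) - (φ (.inl 0) + φ (.inl 1)) / 2) (r := r)
      (div_ne_zero (sub_ne_zero.2 hD.symm) two_ne_zero)
      (by rwa [norm_div, norm_sub_rev, ← norm_div])
      (by rw [← h1]; congr 1; ring) (by rw [← h2, ← norm_neg]; congr 1; ring)
      (by rw [← h3]; congr 1; ring) (by rw [← h4, ← norm_neg]; congr 1; ring)
    refine ⟨ε, ?_, fun δ hδ => hu δ ?_⟩
    · ext (v | v)
      · exact congrFun h v
      · simp only [Sum.elim_inr, hε]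
        ring
    · simp only [← hδ, Sum.elim_inr]
      ring
  sec c := Sum.elim c fun _ => (c 0 + c 1) / 2 + Complex.I * (c 1 - c 0) *
    (√(r ^ 2 / ((c 1 - c 0).re ^ 2 + (c 1 - c 0).im ^ 2) - (1 / 2) ^ 2) : ℝ)
  sec_analytic := by
    have hp : ∀ i : Fin 2, AnalyticOn ℝ (fun c : Fin 2 → ℂ => c i)
        {c | c 0 ≠ c 1 ∧ ‖(c 0 - c 1) / 2‖ < r} :=
      fun i => ((RealPoly.proj i).analyticOnNhd _).analyticOn
    refine analyticOn_pi_iff.2 ?_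
    rintro (v | v)
    · exact hp v
    · refine AnalyticOn.add ?_ (analyticOn_I_mul_sqrt analyticOn_const ((hp 1).sub (hp 0)) ?_ ?_)
      · exact ((((RealPoly.proj 0).add (RealPoly.proj 1)).div_const 2).analyticOnNhd _).analyticOn
      · exact fun c hc => sub_ne_zero.2 hc.1.symm
      · intro c hc
        have e : ((1 / 2 : ℝ) : ℂ) * (c 1 - c 0) = -((c 0 - c 1) / 2) := by
          push_cast
          ring
        change ‖((1 / 2 : ℝ) : ℂ) * (c 1 - c 0)‖ < r
        rw [e, norm_neg]
        exact hc.2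
  sec_mem := by
    rintro c ⟨h1, h2⟩
    have := norm_I_mul_sqrt (s := (c 1 - c 0) / 2) (w := c 1 - c 0) (l := 1 / 2) (r := r)
      (by push_cast; ring) (sub_ne_zero.2 h1.symm) ((norm_nonneg _).trans h2.le)
      (by rw [norm_div, norm_sub_rev, ← norm_div]; exact h2.le)
    constructor
    · refine Eq.trans (congrArg norm ?_) this.1
      simp only [Sum.elim_inl, Sum.elim_inr]
      ring
    · refine Eq.trans ((norm_neg _).symm.trans (congrArg norm ?_)) this.2
      simp only [Sum.elim_inl, Sum.elim_inr]
      ring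
  sec_inl _ _ := rfl

end PolyCover

theorem RealPolyMap.sumElim {ι K W : Type} {F : (ι → ℂ) → (K → ℂ)} {G : (ι → ℂ) → (W → ℂ)}
    (hF : RealPolyMap F) (hG : RealPolyMap G) : RealPolyMap fun x => Sum.elim (F x) (G x) := by
  rintro (j | j)
  · exact hF j
  · exact hG j

namespace PolyCover

/-- The coordinates of the vertices of a rigidified pantograph with ratio `t`. -/
noncomputable def pantographMap (t : ℝ) (φ : Fin 2 ⊕ Unit → ℂ) : Fin 2 ⊕ Fin 6 → ℂ :=
  let a := φ (.inl 0)
  let b := φ (.inl 1)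
  let x := φ (.inr ())
  let m := a + t * (x - a)
  let n := x + t * (b - x)
  let w := a + t * (b - a)
  Sum.elim (φ ∘ Sum.inl) ![x, m, n, (m + x) / 2, (w + n) / 2, w]

theorem realPolyMap_pantographMap (t : ℝ) : RealPolyMap (pantographMap t) := by
  refine (RealPolyMap.reindex _).sumElim fun j => ?_
  fin_cases j <;> dsimp <;>
    repeat first
      | exact RealPoly.proj _
      | apply RealPoly.div_const
      | apply RealPoly.sub
      | apply RealPoly.add
      | apply RealPoly.const_mul

/-- The rigidified pantograph with ratio `t` and arms of length `r`. -/
noncomputable def pantograph (r t : ℝ) :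
    PolyCover (Fin 2) (Fin 6) {c | c 0 ≠ c 1 ∧ ‖(c 0 - c 1) / 2‖ < r} :=
  (apex r).map (pantographMap t) (fun φ => φ ∘ Sum.map id fun _ => 0)
    (realPolyMap_pantographMap t) (RealPolyMap.reindex _)
    (fun φ _ => by ext (v | v) <;> rfl) (fun φ => rfl)

theorem norm_eq_abs_mul {z y : ℂ} {r t : ℝ} (h : ‖y‖ = r) (hz : z = t * y ∨ z = -(t * y)) :
    ‖z‖ = |t| * r := by
  rcases hz with rfl | rfl <;> simp [h]

theorem norm_eq_abs_mul_half {z y : ℂ} {r t : ℝ} (h : ‖y‖ = r)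
    (hz : z = t * y / 2 ∨ z = -(t * y / 2)) : ‖z‖ = |t| * r / 2 := by
  rcases hz with rfl | rfl <;> simp [h]

theorem pantograph_X {r t : ℝ} (hr : 0 < r) : (pantograph r t).X =
    {φ | ‖φ (.inr 0) - φ (.inl 0)‖ = r ∧ ‖φ (.inr 0) - φ (.inl 1)‖ = r ∧
      ‖φ (.inr 1) - φ (.inl 0)‖ = |t| * r ∧ ‖φ (.inr 1) - φ (.inr 0)‖ = |1 - t| * r ∧
      ‖φ (.inr 2) - φ (.inr 0)‖ = |t| * r ∧ ‖φ (.inr 2) - φ (.inl 1)‖ = |1 - t| * r ∧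
      ‖φ (.inr 3) - φ (.inr 1)‖ = |1 - t| * r / 2 ∧ ‖φ (.inr 3) - φ (.inr 0)‖ = |1 - t| * r / 2 ∧
      ‖φ (.inr 5) - φ (.inr 1)‖ = |t| * r ∧ ‖φ (.inr 5) - φ (.inr 2)‖ = |1 - t| * r ∧
      ‖φ (.inr 4) - φ (.inr 5)‖ = |1 - t| * r / 2 ∧ ‖φ (.inr 4) - φ (.inr 2)‖ = |1 - t| * r / 2 ∧
      ‖φ (.inr 3) - φ (.inr 4)‖ = |t| * r} := by
  ext ψ
  constructor
  · rintro ⟨φ, ⟨h1, h2⟩, rfl⟩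
    simp only [Set.mem_ofPred_eq, pantographMap, Sum.elim_inl, Sum.elim_inr, Function.comp_apply,
      Matrix.cons_val]
    generalize φ (.inl 0) = a at *
    generalize φ (.inl 1) = b at *
    generalize φ (.inr ()) = x at *
    have e : ((1 - t : ℝ) : ℂ) = 1 - (t : ℂ) := by push_cast; ring
    refine ⟨h1, h2, ?_, ?_, ?_, ?_, ?_, ?_, ?_, ?_, ?_, ?_, ?_⟩
    · exact norm_eq_abs_mul h1 (Or.inl (by ring))
    · exact norm_eq_abs_mul h1 (Or.inr (by rw [e]; ring))
    · exact norm_eq_abs_mul h2 (Or.inr (by ring))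
    · exact norm_eq_abs_mul h2 (Or.inl (by rw [e]; ring))
    · exact norm_eq_abs_mul_half h1 (Or.inl (by rw [e]; ring))
    · exact norm_eq_abs_mul_half h1 (Or.inr (by rw [e]; ring))
    · exact norm_eq_abs_mul h2 (Or.inr (by ring))
    · exact norm_eq_abs_mul h1 (Or.inr (by rw [e]; ring))
    · exact norm_eq_abs_mul_half h1 (Or.inl (by rw [e]; ring))
    · exact norm_eq_abs_mul_half h1 (Or.inr (by rw [e]; ring))
    · exact norm_eq_abs_mul h2 (Or.inl (by ring))
  · rintro ⟨h1, h2, h3, h4, h5, h6, h7, h8, h9, h10, h11, h12, h13⟩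
    have p : 0 ≤ |1 - t| * r := by positivity
    have e1 := eq_of_dist_bar hr.le h1 h3 h4
    have e2 := eq_of_dist_bar hr.le ((norm_sub_rev _ _).trans h2) h5 h6
    have e3 := eq_midpoint_of_dist p ((norm_sub_rev _ _).trans h4) h7 h8
    have e4 := eq_midpoint_of_dist p ((norm_sub_rev _ _).trans h10) h11 h12
    have e5 := eq_of_norm_half_add (a := ψ (.inr 1) - ψ (.inr 5)) (b := ψ (.inr 0) - ψ (.inr 2))
      ((norm_sub_rev _ _).trans h9) ((norm_sub_rev _ _).trans h5)
      (by rw [← h13, e3, e4]; congr 1; ring)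
    have e6 : ψ (.inr 5) = ψ (.inl 0) + t * (ψ (.inl 1) - ψ (.inl 0)) := by
      rw [e1, e2] at e5
      linear_combination -e5
    refine ⟨ψ ∘ Sum.map id fun _ => 0, ⟨h1, h2⟩, ?_⟩
    ext (j | j)
    · rfl
    · fin_cases j <;> simp only [pantographMap, Sum.elim_inr, Function.comp_apply, Sum.map_inl,
        Sum.map_inr, id, Fin.isValue, Fin.zero_eta, Fin.mk_one, Fin.reduceFinMk, Matrix.cons_val]
      · exact e1.symm
      · exact e2.symm
      · rw [e3, e1]
      · rw [e4, e6, e2]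
      · exact e6.symm

end PolyCover

namespace Realizable

variable {K : Type} [Fintype K] {D : Set (K → ℂ)} {F : Set ((K → ℂ) → ℂ)}

theorem affine (h : Realizable D F) {f g : (K → ℂ) → ℂ} (hf : f ∈ F) (hg : g ∈ F) {t : ℝ}
    (h0 : t ≠ 0) (h1 : t ≠ 1) (hne : ∀ c ∈ D, f c ≠ g c) {M : ℝ} (hM : ∀ c ∈ D, ‖f c - g c‖ ≤ M) :
    Realizable D (insert (fun c => f c + t * (g c - f c)) F) := by
  set r := |M| + 1
  have hr : 0 < r := by positivity
  have p1 : 0 < |t| * r := mul_pos (abs_pos.2 h0) hr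
  have p2 : 0 < |1 - t| * r := mul_pos (abs_pos.2 (sub_ne_zero.2 h1.symm)) hr
  have p3 : 0 < |1 - t| * r / 2 := half_pos p2
  refine h.attach (PolyCover.pantograph r t) ?_ (g := fun c => c 0 + t * (c 1 - c 0))
    ⟨Sum.inr 5, ?_⟩ ![f, g] ?_ ?_
  · rw [PolyCover.pantograph_X hr]
    repeat' first | apply IsConfig.and | apply IsConfig.dist
    all_goals assumption
  · rintro _ ⟨φ, -, rfl⟩
    rfl
  · intro k
    fin_cases k <;> assumption
  · intro c hc
    refine ⟨hne c hc, ?_⟩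
    change ‖(f c - g c) / 2‖ < r
    rw [norm_div, Complex.norm_ofNat]
    have := hM c hc
    have := le_abs_self M
    have := norm_nonneg (f c - g c)
    change _ < |M| + 1
    linarith

end Realizable

/-- The ratio of the center of the rhombus of an inversor of power `1` to its input vertex. -/
noncomputable def rhombusRatio (z : ℂ) : ℝ :=
  (1 + (z.re ^ 2 + z.im ^ 2)) / (2 * (z.re ^ 2 + z.im ^ 2))

theorem re_sq_add_im_sq_pos {z : ℂ} (hz : z ≠ 0) : 0 < z.re ^ 2 + z.im ^ 2 := by
  rw [sq, sq, ← Complex.normSq_apply]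
  exact Complex.normSq_pos.2 hz

theorem rhombusRatio_pos {z : ℂ} (hz : z ≠ 0) : 0 < rhombusRatio z := by
  have := re_sq_add_im_sq_pos hz
  unfold rhombusRatio
  positivity

theorem two_mul_rhombusRatio_mul_sub {z : ℂ} (hz : z ≠ 0) :
    2 * (rhombusRatio z * z) - z = 1 / (starRingEnd ℂ) z := by
  have h := (re_sq_add_im_sq_pos hz).ne'
  rw [eq_div_iff ((map_ne_zero (starRingEnd ℂ)).2 hz)]
  have e : z * (starRingEnd ℂ) z = ((z.re ^ 2 + z.im ^ 2 : ℝ) : ℂ) := by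
    rw [Complex.mul_conj, Complex.normSq_apply, sq, sq]
  have e' : (2 * rhombusRatio z - 1) * (z.re ^ 2 + z.im ^ 2) = 1 := by
    unfold rhombusRatio
    field_simp
    ring
  calc (2 * (rhombusRatio z * z) - z) * (starRingEnd ℂ) z
      = (2 * rhombusRatio z - 1) * (z * (starRingEnd ℂ) z) := by ring
    _ = (((2 * rhombusRatio z - 1) * (z.re ^ 2 + z.im ^ 2) : ℝ) : ℂ) := by rw [e]; push_cast; ring
    _ = 1 := by rw [e', Complex.ofReal_one]

theorem norm_lt_of_rhombus {s k : ℂ} {ρ R : ℝ} (h1 : ‖s + k‖ = ρ) (h2 : ‖s - k‖ = ρ)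
    (hR : ρ < R) : ‖s‖ < R := by
  have h : ‖(s + k) + (s - k)‖ ≤ ‖s + k‖ + ‖s - k‖ := norm_add_le _ _
  rw [add_add_sub_cancel, ← two_mul, norm_mul, Complex.norm_ofNat, h1, h2] at h
  linarith

/-- The center of the rhombus of an inversor of power `1` is determined by the input vertex. -/
theorem inversor_center {z s d : ℂ} {R r : ℝ} (hr : 0 ≤ r) (hRr : R ^ 2 - r ^ 2 = 1)
    (h1 : ‖s + d‖ = R) (h2 : ‖s - d‖ = R) (h3 : ‖s + d - z‖ = r) (h4 : ‖s - d - z‖ = r)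
    (hs : ‖s‖ < R) : z ≠ 0 ∧ s = rhombusRatio z * z := by
  have hz : z ≠ 0 := by
    rintro rfl
    rw [sub_zero, h1] at h3
    rw [h3, sub_self] at hRr
    exact zero_ne_one hRr
  refine ⟨hz, ?_⟩
  have hR : 0 ≤ R := h1 ▸ norm_nonneg _
  have hd : d ≠ 0 := by
    rintro rfl
    rw [add_zero] at h1
    exact hs.ne h1
  have hd' := (re_sq_add_im_sq_pos hd).ne'
  have hq := (re_sq_add_im_sq_pos hz).ne'
  rw [Complex.norm_eq_iff_sq hR] at h1 h2
  rw [Complex.norm_eq_iff_sq hr] at h3 h4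
  simp only [Complex.sub_re, Complex.sub_im, Complex.add_re, Complex.add_im] at h1 h2 h3 h4
  have hsd : s.re * d.re + s.im * d.im = 0 := by linarith
  have hzd : z.re * d.re + z.im * d.im = 0 := by linarith
  have hsz : 2 * (s.re * z.re + s.im * z.im) = 1 + (z.re ^ 2 + z.im ^ 2) := by linarith
  have hcross : s.re * z.im - s.im * z.re = 0 := by
    refine (mul_eq_zero.1 (?_ : _ * (d.re ^ 2 + d.im ^ 2) = 0)).resolve_right hd'
    linear_combination (z.im * d.re - z.re * d.im) * hsd +
      (s.re * d.im - s.im * d.re) * hzd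
  have hl : rhombusRatio z * (z.re ^ 2 + z.im ^ 2) = s.re * z.re + s.im * z.im := by
    unfold rhombusRatio
    rw [← hsz]
    field_simp
  apply Complex.ext
  · rw [Complex.re_ofReal_mul]
    refine mul_right_cancel₀ hq ?_
    linear_combination z.im * hcross - z.re * hl
  · rw [Complex.im_ofReal_mul]
    refine mul_right_cancel₀ hq ?_
    linear_combination -z.re * hcross - z.im * hl

/-- The circles of an inversor of power `1` meet over the admissible input vertices. -/
theorem inversor_norm {z d : ℂ} {R r : ℝ} (hr : 0 ≤ r) (hRr : R ^ 2 - r ^ 2 = 1) (hz : z ≠ 0)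
    (h1 : ‖rhombusRatio z * z + d‖ = R) : ‖rhombusRatio z * z + d - z‖ = r ↔
      z.re * d.re + z.im * d.im = 0 := by
  have hq := (re_sq_add_im_sq_pos hz).ne'
  have hR : 0 ≤ R := h1 ▸ norm_nonneg _
  rw [Complex.norm_eq_iff_sq hR] at h1
  rw [Complex.norm_eq_iff_sq hr]
  simp only [Complex.sub_re, Complex.sub_im, Complex.add_re, Complex.add_im, Complex.re_ofReal_mul,
    Complex.im_ofReal_mul] at h1 ⊢
  have hl : 2 * rhombusRatio z * (z.re ^ 2 + z.im ^ 2) = 1 + (z.re ^ 2 + z.im ^ 2) := by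
    unfold rhombusRatio
    field_simp
  constructor <;> intro h
  · linear_combination (h1 - h - hl + hRr) / 2
  · linear_combination h1 - hl + hRr - 2 * h

namespace PolyCover

/-- The vertices `s + d`, `s - d` of the rhombus of an inversor with center `s`, and a rhombus with
diagonals `2 * s` and `2 * k` that keeps `d` away from zero. -/
noncomputable def inversorCore (R r ρ : ℝ) (hr : 0 ≤ r) (hRr : R ^ 2 - r ^ 2 = 1) (hR : ρ < R) :
    PolyCover (Fin 1) (Fin 3) {c | c 0 ≠ 0 ∧ ‖(rhombusRatio (c 0) : ℂ) * c 0‖ < ρ} where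
  X := {φ | (‖φ (.inr 0) + φ (.inr 1)‖ = R ∧ ‖φ (.inr 0) - φ (.inr 1)‖ = R) ∧
    (‖φ (.inr 0) + φ (.inr 1) - φ (.inl 0)‖ = r ∧ ‖φ (.inr 0) - φ (.inr 1) - φ (.inl 0)‖ = r) ∧
    (‖φ (.inr 0) + φ (.inr 2)‖ = ρ ∧ ‖φ (.inr 0) - φ (.inr 2)‖ = ρ)}
  G := ℤˣ × ℤˣ
  act ε φ := Sum.elim (φ ∘ Sum.inl)
    ![φ (.inr 0), (ε.1 : ℤ) * φ (.inr 1), (ε.2 : ℤ) * φ (.inr 2)]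
  act_poly ε := by
    refine (RealPolyMap.reindex _).sumElim fun j => ?_
    fin_cases j
    exacts [RealPoly.proj _, (RealPoly.proj _).const_mul _, (RealPoly.proj _).const_mul _]
  act_mem := by
    rintro ε φ ⟨⟨h1, h2⟩, ⟨h3, h4⟩, ⟨h5, h6⟩⟩
    refine ⟨norm_unit_mul_rhombus ε.1 h1 h2, ?_, norm_unit_mul_rhombus ε.2 h5 h6⟩
    have h7 := norm_unit_mul_rhombus (s := φ (.inr 0) - φ (.inl 0)) (y := φ (.inr 1)) (r := r) ε.1
      (by rw [← h3]; congr 1; ring) (by rw [← h4]; congr 1; ring)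
    constructor
    · refine Eq.trans (congrArg norm ?_) h7.1
      simp only [Sum.elim_inl, Sum.elim_inr, Function.comp_apply, Matrix.cons_val]
      ring
    · refine Eq.trans (congrArg norm ?_) h7.2
      simp only [Sum.elim_inl, Sum.elim_inr, Function.comp_apply, Matrix.cons_val]
      ring
  act_one φ _ := by
    ext (v | v)
    · rfl
    · fin_cases v <;> simp
  act_mul ε δ φ _ := by
    ext (v | v)
    · rfl
    · fin_cases v <;> simp [mul_assoc]
  act_inl _ _ _ := rfl
  transitive := by
    rintro φ ⟨⟨h1, h2⟩, ⟨h3, h4⟩, ⟨h5, h6⟩⟩ ψ ⟨⟨g1, g2⟩, ⟨g3, g4⟩, ⟨g5, g6⟩⟩ ⟨hD, hD'⟩ h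
    have e : φ (.inl 0) = ψ (.inl 0) := congrFun h 0
    simp only [Function.comp_apply] at hD hD'
    obtain ⟨-, hs⟩ := inversor_center hr hRr h1 h2 h3 h4 (norm_lt_of_rhombus h5 h6 hR)
    obtain ⟨-, hs'⟩ := inversor_center hr hRr g1 g2 g3 g4 (norm_lt_of_rhombus g5 g6 hR)
    rw [← e, ← hs] at hs'
    rw [← hs] at hD'
    rw [hs'] at g1 g2 g5 g6
    have hs0 : φ (.inr 0) ≠ 0 := by
      rw [hs]
      exact mul_ne_zero (Complex.ofReal_ne_zero.2 (rhombusRatio_pos hD).ne') hD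
    obtain ⟨ε, hε, hεu⟩ := existsUnique_unit_mul hs0 (hD'.trans hR) h1 h2 g1 g2
    obtain ⟨δ, hδ, hδu⟩ := existsUnique_unit_mul hs0 hD' h5 h6 g5 g6
    refine ⟨(ε, δ), ?_, ?_⟩
    · ext (v | v)
      · exact congrFun h v
      · fin_cases v
        exacts [hs'.symm, hε, hδ]
    · rintro ⟨ε', δ'⟩ h'
      exact Prod.ext (hεu _ (congrFun h' (.inr 1))) (hδu _ (congrFun h' (.inr 2)))
  sec c := Sum.elim c ![rhombusRatio (c 0) * c 0,
    Complex.I * c 0 * (√(R ^ 2 / ((c 0).re ^ 2 + (c 0).im ^ 2) - rhombusRatio (c 0) ^ 2) : ℝ),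
    Complex.I * c 0 * (√(ρ ^ 2 / ((c 0).re ^ 2 + (c 0).im ^ 2) - rhombusRatio (c 0) ^ 2) : ℝ)]
  sec_analytic := by
    have hp : ∀ i : Fin 1, AnalyticOn ℝ (fun c : Fin 1 → ℂ => c i)
        {c | c 0 ≠ 0 ∧ ‖(rhombusRatio (c 0) : ℂ) * c 0‖ < ρ} :=
      fun i => ((RealPoly.proj i).analyticOnNhd _).analyticOn
    have hl : AnalyticOn ℝ (fun c : Fin 1 → ℂ => rhombusRatio (c 0))
        {c | c 0 ≠ 0 ∧ ‖(rhombusRatio (c 0) : ℂ) * c 0‖ < ρ} := by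
      refine (analyticOn_const.add (hp 0).re_sq_add_im_sq).div
        (analyticOn_const.mul (hp 0).re_sq_add_im_sq) ?_
      exact fun c hc => mul_ne_zero two_ne_zero (re_sq_add_im_sq_pos hc.1).ne'
    refine analyticOn_pi_iff.2 ?_
    rintro (v | v)
    · exact hp v
    · fin_cases v
      · exact hl.ofReal.mul (hp 0)
      · exact analyticOn_I_mul_sqrt hl (hp 0) (fun c hc => hc.1) fun c hc => hc.2.trans hR
      · exact analyticOn_I_mul_sqrt hl (hp 0) (fun c hc => hc.1) fun c hc => hc.2
  sec_mem := by
    rintro c ⟨h1, h2⟩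
    have hρ : 0 ≤ ρ := (norm_nonneg _).trans h2.le
    have p1 := norm_I_mul_sqrt (r := R) rfl h1 (hρ.trans hR.le) (h2.le.trans hR.le)
    have p2 := norm_I_mul_sqrt (r := ρ) rfl h1 hρ h2.le
    refine ⟨p1, ⟨?_, ?_⟩, p2⟩
    · refine (inversor_norm hr hRr h1 p1.1).2 ?_
      simp
      ring
    · have p1' := p1.2
      rw [sub_eq_add_neg] at p1'
      have := (inversor_norm hr hRr h1 p1').2 (by simp; ring)
      rwa [← sub_eq_add_neg] at this
  sec_inl _ _ := rfl

/-- The coordinates of the vertices of a rigidified inversor. -/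
noncomputable def inversorMap (φ : Fin 1 ⊕ Fin 3 → ℂ) : Fin 1 ⊕ Fin 8 → ℂ :=
  let z := φ (.inl 0)
  let s := φ (.inr 0)
  let d := φ (.inr 1)
  let k := φ (.inr 2)
  Sum.elim (φ ∘ Sum.inl) ![0, s + d, s - d, -(s + d), k - d, (z + (s + d)) / 2,
    (s - d + (2 * s - z)) / 2, 2 * s - z]

theorem realPolyMap_inversorMap : RealPolyMap inversorMap := by
  refine (RealPolyMap.reindex _).sumElim fun j => ?_
  fin_cases j <;> dsimp <;>
    repeat first
      | exact RealPoly.proj _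
      | exact RealPoly.const _
      | apply RealPoly.div_const
      | apply RealPoly.sub
      | apply RealPoly.add
      | apply RealPoly.neg
      | apply RealPoly.const_mul

/-- The coordinates of the core in terms of the vertices of an inversor. -/
noncomputable def inversorInvMap (ψ : Fin 1 ⊕ Fin 8 → ℂ) : Fin 1 ⊕ Fin 3 → ℂ :=
  Sum.elim (ψ ∘ Sum.inl) ![(ψ (.inr 1) + ψ (.inr 2)) / 2, (ψ (.inr 1) - ψ (.inr 2)) / 2,
    ψ (.inr 4) + (ψ (.inr 1) - ψ (.inr 2)) / 2]

theorem realPolyMap_inversorInvMap : RealPolyMap inversorInvMap := by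
  refine (RealPolyMap.reindex _).sumElim fun j => ?_
  fin_cases j <;> dsimp <;>
    repeat first
      | exact RealPoly.proj _
      | apply RealPoly.div_const
      | apply RealPoly.sub
      | apply RealPoly.add

/-- The rigidified inversor of power `1`. -/
noncomputable def inversor (R r ρ : ℝ) (hr : 0 ≤ r) (hRr : R ^ 2 - r ^ 2 = 1) (hR : ρ < R) :
    PolyCover (Fin 1) (Fin 8) {c | c 0 ≠ 0 ∧ ‖(rhombusRatio (c 0) : ℂ) * c 0‖ < ρ} :=
  (inversorCore R r ρ hr hRr hR).map inversorMap inversorInvMap realPolyMap_inversorMap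
    realPolyMap_inversorInvMap
    (fun φ _ => by
      ext (v | v)
      · rfl
      · fin_cases v <;> simp [inversorMap, inversorInvMap])
    (fun φ => rfl)

theorem inversor_X {R r ρ : ℝ} (hr : 0 ≤ r) (hRr : R ^ 2 - r ^ 2 = 1) (hR : ρ < R) :
    (inversor R r ρ hr hRr hR).X =
    {ψ | ψ (.inr 0) = 0 ∧ ‖ψ (.inr 1) - ψ (.inr 0)‖ = R ∧ ‖ψ (.inr 2) - ψ (.inr 0)‖ = R ∧
      ‖ψ (.inr 1) - ψ (.inl 0)‖ = r ∧ ‖ψ (.inr 2) - ψ (.inl 0)‖ = r ∧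
      ‖ψ (.inr 3) - ψ (.inr 0)‖ = R ∧ ‖ψ (.inr 3) - ψ (.inr 1)‖ = 2 * R ∧
      ‖ψ (.inr 4) - ψ (.inr 3)‖ = ρ ∧ ‖ψ (.inr 4) - ψ (.inr 2)‖ = ρ ∧
      ‖ψ (.inr 5) - ψ (.inl 0)‖ = r / 2 ∧ ‖ψ (.inr 5) - ψ (.inr 1)‖ = r / 2 ∧
      ‖ψ (.inr 6) - ψ (.inr 2)‖ = r / 2 ∧ ‖ψ (.inr 6) - ψ (.inr 7)‖ = r / 2 ∧
      ‖ψ (.inr 7) - ψ (.inr 2)‖ = r ∧ ‖ψ (.inr 7) - ψ (.inr 1)‖ = r ∧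
      ‖ψ (.inr 5) - ψ (.inr 6)‖ = r} := by
  have half : ∀ {y z : ℂ} {a : ℝ}, ‖y‖ = a → z = y / 2 ∨ z = -(y / 2) → ‖z‖ = a / 2 := by
    rintro y z a h (rfl | rfl) <;> simp [h]
  have sgn : ∀ {y z : ℂ} {a : ℝ}, ‖y‖ = a → z = y ∨ z = -y → ‖z‖ = a := by
    rintro y z a h (rfl | rfl) <;> simp [h]
  ext ψ
  constructor
  · rintro ⟨φ, ⟨⟨h1, h2⟩, ⟨h3, h4⟩, ⟨h5, h6⟩⟩, rfl⟩
    simp only [Set.mem_ofPred_eq, inversorMap, Sum.elim_inl, Sum.elim_inr, Function.comp_apply,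
      Matrix.cons_val]
    refine ⟨trivial, ?_, ?_, h3, h4, ?_, ?_, ?_, ?_, ?_, ?_, ?_, ?_, ?_, ?_, ?_⟩
    · exact sgn h1 (Or.inl (by ring))
    · exact sgn h2 (Or.inl (by ring))
    · exact sgn h1 (Or.inr (by ring))
    · rw [← h1, ← Complex.norm_two, ← norm_mul]
      exact sgn rfl (Or.inr (by ring))
    · exact sgn h5 (Or.inl (by ring))
    · exact sgn h6 (Or.inr (by ring))
    · exact half h3 (Or.inl (by ring))
    · exact half h3 (Or.inr (by ring))
    · exact half h3 (Or.inl (by ring))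
    · exact half h3 (Or.inr (by ring))
    · exact sgn h3 (Or.inl (by ring))
    · exact sgn h4 (Or.inl (by ring))
    · exact sgn h4 (Or.inr (by ring))
  · rintro ⟨h0, h1, h2, h3, h4, h5, h6, h7, h8, h9, h10, h11, h12, h13, h14, h15⟩
    have hR0 : 0 ≤ R := h1 ▸ norm_nonneg _
    have e3 : ψ (.inr 3) = -ψ (.inr 1) := by
      have := eq_of_dist_bar (a := ψ (.inr 0)) (x := ψ (.inr 1)) (m := ψ (.inr 3)) (t := -1) hR0 h1
        (by rw [h5]; norm_num) (by rw [h6]; norm_num)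
      rw [this, h0]
      push_cast
      ring
    have e5 := eq_midpoint_of_dist hr h3 h9 h10
    have e6 := eq_midpoint_of_dist hr h13 h11 h12
    have e7 := eq_of_norm_half_add (a := ψ (.inl 0) - ψ (.inr 2)) (b := ψ (.inr 1) - ψ (.inr 7))
      ((norm_sub_rev _ _).trans h4) ((norm_sub_rev _ _).trans h14)
      (by rw [← h15, e5, e6]; congr 1; ring)
    have e7' : ψ (.inr 7) = ψ (.inr 1) + ψ (.inr 2) - ψ (.inl 0) := by linear_combination e7
    rw [h0, sub_zero] at h1 h2
    rw [e3] at h7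
    refine ⟨inversorInvMap ψ, ⟨⟨?_, ?_⟩, ⟨?_, ?_⟩, ⟨?_, ?_⟩⟩, ?_⟩
    · exact sgn h1 (Or.inl (by simp [inversorInvMap]; ring))
    · exact sgn h2 (Or.inl (by simp [inversorInvMap]; ring))
    · exact sgn h3 (Or.inl (by simp [inversorInvMap]; ring))
    · exact sgn h4 (Or.inl (by simp [inversorInvMap]; ring))
    · exact sgn h7 (Or.inl (by simp [inversorInvMap]; ring))
    · exact sgn h8 (Or.inr (by simp [inversorInvMap]; ring))
    · ext (j | j)
      · rfl
      · fin_cases j <;> simp only [inversorMap, inversorInvMap, Sum.elim_inr, Sum.elim_inl,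
          Function.comp_apply, Fin.isValue, Fin.zero_eta, Fin.mk_one, Fin.reduceFinMk,
          Matrix.cons_val]
        · exact h0.symm
        · ring
        · ring
        · rw [e3]; ring
        · ring
        · rw [e5]; ring
        · rw [e6, e7']; ring
        · rw [e7']; ring

theorem ne_zero_of_mem_inversor_X {R r ρ : ℝ} (hr : 0 ≤ r) (hRr : R ^ 2 - r ^ 2 = 1)
    (hR : ρ < R) : ∀ ψ ∈ (inversor R r ρ hr hRr hR).X, ψ (.inl 0) ≠ 0 := by
  rintro _ ⟨φ, ⟨⟨h1, h2⟩, ⟨h3, h4⟩, ⟨h5, h6⟩⟩, rfl⟩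
  exact (inversor_center hr hRr h1 h2 h3 h4 (norm_lt_of_rhombus h5 h6 hR)).1

theorem inversor_computes {R r ρ : ℝ} (hr : 0 ≤ r) (hRr : R ^ 2 - r ^ 2 = 1) (hR : ρ < R) :
    (inversor R r ρ hr hRr hR).Computes fun c => 1 / (starRingEnd ℂ) (c 0) := by
  refine ⟨.inr 7, ?_⟩
  rintro _ ⟨φ, ⟨⟨h1, h2⟩, ⟨h3, h4⟩, ⟨h5, h6⟩⟩, rfl⟩
  obtain ⟨hz, hs⟩ := inversor_center hr hRr h1 h2 h3 h4 (norm_lt_of_rhombus h5 h6 hR)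
  refine Eq.trans ?_ (two_mul_rhombusRatio_mul_sub hz)
  change _ = 2 * ((rhombusRatio (φ (.inl 0)) : ℂ) * φ (.inl 0)) - φ (.inl 0)
  rw [← hs]
  rfl

theorem norm_rhombusRatio_mul {z : ℂ} (hz : z ≠ 0) :
    ‖(rhombusRatio z : ℂ) * z‖ = (‖z‖ + 1 / ‖z‖) / 2 := by
  have h : z.re ^ 2 + z.im ^ 2 = ‖z‖ ^ 2 := by
    rw [← Complex.normSq_eq_norm_sq, Complex.normSq_apply, sq, sq]
  have hz' := norm_pos_iff.2 hz
  rw [norm_mul, Complex.norm_real, Real.norm_of_nonneg (rhombusRatio_pos hz).le, rhombusRatio, h]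
  field_simp
  ring

/-- There are inversors of power `1` over any annulus. -/
theorem exists_inversor {δ : ℝ} (hδ : 0 < δ) (M : ℝ) :
    ∃ (D : Set (Fin 1 → ℂ)) (C : PolyCover (Fin 1) (Fin 8) D), IsConfig C.X ∧
      C.Computes (fun c => 1 / (starRingEnd ℂ) (c 0)) ∧ (∀ ψ ∈ C.X, ψ (.inl 0) ≠ 0) ∧
      ∀ z : ℂ, δ ≤ ‖z‖ → ‖z‖ ≤ M → (fun _ => z) ∈ D := by
  set ρ := (|M| + 1 / δ) / 2 + 1 with hρ
  have hM := le_abs_self M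
  have hρ1 : 1 ≤ ρ := by
    have : 0 ≤ |M| + 1 / δ := by positivity
    linarith
  have hr : 0 < √((ρ + 1) ^ 2 - 1) := Real.sqrt_pos.2 (by nlinarith)
  have hRr : (ρ + 1) ^ 2 - √((ρ + 1) ^ 2 - 1) ^ 2 = 1 := by
    rw [Real.sq_sqrt (by nlinarith)]
    ring
  refine ⟨_, PolyCover.inversor (ρ + 1) _ ρ hr.le hRr (by linarith), ?_,
    PolyCover.inversor_computes _ _ _, PolyCover.ne_zero_of_mem_inversor_X _ _ _, ?_⟩
  · rw [PolyCover.inversor_X]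
    refine (IsConfig.fixed _ _).and ?_
    repeat' first | apply IsConfig.and | apply IsConfig.dist
    all_goals linarith
  · intro z h1 h2
    have hne : z ≠ 0 := norm_pos_iff.1 (hδ.trans_le h1)
    refine ⟨hne, ?_⟩
    change ‖(rhombusRatio z : ℂ) * z‖ < ρ
    rw [norm_rhombusRatio_mul hne]
    have h3 := one_div_le_one_div_of_le hδ h1
    linarith

end PolyCover

namespace Realizable

variable {K : Type} [Fintype K] {D : Set (K → ℂ)} {F : Set ((K → ℂ) → ℂ)}

theorem inv_conj (h : Realizable D F) {f : (K → ℂ) → ℂ} (hf : f ∈ F) {δ M : ℝ} (hδ : 0 < δ)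
    (hfδ : ∀ c ∈ D, δ ≤ ‖f c‖) (hfM : ∀ c ∈ D, ‖f c‖ ≤ M) :
    Realizable D (insert (fun c => 1 / (starRingEnd ℂ) (f c)) F) := by
  obtain ⟨D₂, C₂, hC₂, hg, -, hD⟩ := PolyCover.exists_inversor hδ M
  exact h.attach C₂ hC₂ hg (fun _ => f) (fun _ => hf) fun c hc => hD _ (hfδ c hc) (hfM c hc)

/-- A computed function can be changed at the zeros of a function that has no zeros near `D`. -/
theorem congr_of_ne (h : Realizable D F) {f g g' : (K → ℂ) → ℂ} (hf : f ∈ F) (hg : g ∈ F)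
    {δ M : ℝ} (hδ : 0 < δ) (hfδ : ∀ c ∈ D, δ ≤ ‖f c‖) (hfM : ∀ c ∈ D, ‖f c‖ ≤ M)
    (hg' : ∀ c, f c ≠ 0 → g' c = g c) : Realizable D (insert g' F) := by
  obtain ⟨D₂, C₂, hC₂, -, hne, hD⟩ := PolyCover.exists_inversor hδ M
  obtain ⟨W, i, C, hC, h1, -, h2⟩ := h.exists_attach C₂ hC₂ (fun _ => f) (fun _ => hf)
    fun c hc => hD _ (hfδ c hc) (hfM c hc)
  refine ⟨W, i, C, hC, ?_⟩
  rintro g'' (rfl | hg'')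
  · obtain ⟨v, hv⟩ := h1 g hg
    refine ⟨v, fun φ hφ => (hv φ hφ).trans (hg' _ ?_).symm⟩
    obtain ⟨ψ, hψ, e⟩ := h2 φ hφ
    exact congrFun e 0 ▸ hne ψ hψ
  · exact h1 g'' hg''

end Realizable

/-- The function `f` is bounded on `D`. -/
def BoundedFun {X : Type} (D : Set X) (f : X → ℂ) : Prop := ∃ M, ∀ c ∈ D, ‖f c‖ ≤ M

namespace BoundedFun

variable {X : Type} {D : Set X} {f g : X → ℂ}

theorem const (a : ℂ) : BoundedFun D (fun _ => a) := ⟨‖a‖, fun _ _ => le_rfl⟩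

theorem add (hf : BoundedFun D f) (hg : BoundedFun D g) : BoundedFun D (fun c => f c + g c) := by
  obtain ⟨M, hM⟩ := hf
  obtain ⟨N, hN⟩ := hg
  exact ⟨M + N, fun c hc => (norm_add_le _ _).trans (add_le_add (hM c hc) (hN c hc))⟩

theorem mul (hf : BoundedFun D f) (hg : BoundedFun D g) : BoundedFun D (fun c => f c * g c) := by
  obtain ⟨M, hM⟩ := hf
  obtain ⟨N, hN⟩ := hg
  refine ⟨M * N, fun c hc => ?_⟩
  rw [norm_mul]
  exact mul_le_mul (hM c hc) (hN c hc) (norm_nonneg _) ((norm_nonneg _).trans (hM c hc))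

theorem const_mul (a : ℂ) (hf : BoundedFun D f) : BoundedFun D (fun c => a * f c) :=
  (const a).mul hf

theorem sub (hf : BoundedFun D f) (hg : BoundedFun D g) : BoundedFun D (fun c => f c - g c) := by
  simpa [sub_eq_add_neg] using hf.add (hg.const_mul (-1))

theorem exists_nonneg (hf : BoundedFun D f) : ∃ M, 0 ≤ M ∧ ∀ c ∈ D, ‖f c‖ ≤ M := by
  obtain ⟨M, hM⟩ := hf
  exact ⟨|M|, abs_nonneg M, fun c hc => (hM c hc).trans (le_abs_self M)⟩

theorem inv_conj {δ : ℝ} (hδ : 0 < δ) (h : ∀ c ∈ D, δ ≤ ‖f c‖) :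
    BoundedFun D (fun c => 1 / (starRingEnd ℂ) (f c)) := by
  refine ⟨1 / δ, fun c hc => ?_⟩
  rw [norm_div, norm_one, RCLike.norm_conj]
  exact one_div_le_one_div_of_le hδ (h c hc)

end BoundedFun

/-- The function `f` can be computed after the functions in `F`. -/
def Derivable {K : Type} [Fintype K] (D : Set (K → ℂ)) (F : Set ((K → ℂ) → ℂ))
    (f : (K → ℂ) → ℂ) : Prop :=
  ∀ F', F ⊆ F' → Realizable D F' → Realizable D (insert f F')

namespace Derivable

variable {K : Type} [Fintype K] {D : Set (K → ℂ)} {F : Set ((K → ℂ) → ℂ)} {f g : (K → ℂ) → ℂ}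

theorem of_mem (hf : f ∈ F) : Derivable D F f := by
  intro F' hF h
  rwa [Set.insert_eq_of_mem (hF hf)]

theorem cut (hf : Derivable D F f) (hg : Derivable D (insert f F) g) : Derivable D F g := by
  intro F' hF h
  refine (hg _ (Set.insert_subset_insert hF) (hf F' hF h)).mono ?_
  exact Set.insert_subset_insert (Set.subset_insert _ _)

theorem mono {F₂ : Set ((K → ℂ) → ℂ)} (hf : Derivable D F f) (h : F ⊆ F₂) : Derivable D F₂ f :=
  fun F' hF => hf F' (h.trans hF)

theorem const (a : ℂ) : Derivable D F (fun _ => a) := fun _ _ h => h.const a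

theorem affine (hf : Derivable D F f) (hg : Derivable D F g) (bf : BoundedFun D f)
    (bg : BoundedFun D g) {t : ℝ} (h0 : t ≠ 0) (h1 : t ≠ 1) (hne : ∀ c ∈ D, f c ≠ g c) :
    Derivable D F (fun c => f c + t * (g c - f c)) := by
  refine hf.cut (cut (hg.mono (Set.subset_insert _ _)) ?_)
  intro F' hF h
  obtain ⟨M, hM⟩ := bf.sub bg
  exact h.affine (hF (by simp)) (hF (by simp)) h0 h1 hne hM

theorem inv_conj (hf : Derivable D F f) (bf : BoundedFun D f) {δ : ℝ} (hδ : 0 < δ)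
    (h : ∀ c ∈ D, δ ≤ ‖f c‖) : Derivable D F (fun c => 1 / (starRingEnd ℂ) (f c)) := by
  refine hf.cut fun F' hF h' => ?_
  obtain ⟨M, hM⟩ := bf
  exact h'.inv_conj (hF (by simp)) hδ h hM

theorem congr_of_ne {g' : (K → ℂ) → ℂ} (hf : Derivable D F f) (hg : Derivable D F g)
    (bf : BoundedFun D f) {δ : ℝ} (hδ : 0 < δ) (h : ∀ c ∈ D, δ ≤ ‖f c‖)
    (hg' : ∀ c, f c ≠ 0 → g' c = g c) : Derivable D F g' := by
  refine hf.cut (cut (hg.mono (Set.subset_insert _ _)) ?_)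
  intro F' hF h'
  obtain ⟨M, hM⟩ := bf
  exact h'.congr_of_ne (hF (by simp)) (hF (by simp)) hδ h hM hg'

theorem add (hf : Derivable D F f) (hg : Derivable D F g) (bf : BoundedFun D f)
    (bg : BoundedFun D g) : Derivable D F (fun c => f c + g c) := by
  obtain ⟨M, hM0, hM⟩ := bf.exists_nonneg
  obtain ⟨N, hN0, hN⟩ := bg.exists_nonneg
  set C : ℝ := 4 * (M + N) + 4
  have hC : ∀ x : ℂ, ‖x‖ ≤ 2 * (M + N) → x ≠ (C / 2 : ℝ) := by
    rintro _ hx rfl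
    rw [Complex.norm_real, Real.norm_of_nonneg (by positivity)] at hx
    simp only [C] at hx
    linarith
  have d1 := hg.affine (const (C : ℂ)) bg (.const _) (t := 1 / 2) (by norm_num) (by norm_num)
    (fun c hc h => hC (g c / 2) (by
      rw [norm_div, Complex.norm_ofNat]
      linarith [hN c hc]) (by rw [h]; push_cast; ring))
  have b1 := bg.add (((BoundedFun.const (C : ℂ)).sub bg).const_mul ((1 / 2 : ℝ) : ℂ))
  have d2 := hf.affine d1 bf b1 (t := 2 / 3) (by norm_num) (by norm_num)
    (fun c hc h => hC (f c - g c / 2) (by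
      have := norm_sub_le (f c) (g c / 2)
      rw [norm_div, Complex.norm_ofNat] at this
      linarith [hM c hc, hN c hc]) (by rw [h]; push_cast; ring))
  have b2 := bf.add ((b1.sub bf).const_mul ((2 / 3 : ℝ) : ℂ))
  have d3 := (const (D := D) (F := F) ((C / 2 : ℝ) : ℂ)).affine d2 (.const _) b2 (t := 3)
    (by norm_num) (by norm_num)
    (fun c hc h => hC (f c + g c) (by
      have := norm_add_le (f c) (g c)
      linarith [hM c hc, hN c hc]) (by
        push_cast at h ⊢
        linear_combination -3 * h))
  convert d3 using 2 with c
  push_cast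
  ring

theorem real_mul (hf : Derivable D F f) (bf : BoundedFun D f) {t : ℝ} (h0 : t ≠ 0) (h1 : t ≠ 1) :
    Derivable D F (fun c => t * f c) := by
  obtain ⟨M, hM0, hM⟩ := bf.exists_nonneg
  have d1 := (const (D := D) (F := F) ((M + 1 : ℝ) : ℂ)).affine hf (.const _) bf h0 h1
    (fun c hc h => by
      have := hM c hc
      rw [← h, Complex.norm_real, Real.norm_of_nonneg (by positivity)] at this
      linarith)
  have b1 := (BoundedFun.const (D := D) ((M + 1 : ℝ) : ℂ)).add
    ((bf.sub (.const ((M + 1 : ℝ) : ℂ))).const_mul t)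
  have d2 := d1.add (const (((t - 1) * (M + 1) : ℝ) : ℂ)) b1 (.const _)
  convert d2 using 2 with c
  push_cast
  ring

theorem sub (hf : Derivable D F f) (hg : Derivable D F g) (bf : BoundedFun D f)
    (bg : BoundedFun D g) : Derivable D F (fun c => f c - g c) := by
  have := hf.add (hg.real_mul bg (t := -1) (by norm_num) (by norm_num)) bf (bg.const_mul _)
  convert this using 2 with c
  push_cast
  ring

theorem sq (hf : Derivable D F f) (bf : BoundedFun D f) : Derivable D F (fun c => f c * f c) := by
  obtain ⟨M, hM0, hM⟩ := bf.exists_nonneg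
  set k : ℝ := M + 1
  have hk : ‖(k : ℂ)‖ = M + 1 := by
    rw [Complex.norm_real, Real.norm_of_nonneg (by positivity)]
  have ha : ∀ c ∈ D, 1 ≤ ‖f c - k‖ := by
    intro c hc
    have := norm_sub_norm_le (k : ℂ) (f c)
    rw [norm_sub_rev, hk] at this
    linarith [hM c hc]
  have hb : ∀ c ∈ D, 1 ≤ ‖f c + k‖ := by
    intro c hc
    have := norm_sub_norm_le (k : ℂ) (-f c)
    rw [norm_neg, sub_neg_eq_add, add_comm (k : ℂ), hk] at this
    linarith [hM c hc]
  have da' := hf.sub (const (k : ℂ)) bf (.const _)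
  have db' := hf.add (const (k : ℂ)) bf (.const _)
  have da := da'.inv_conj (bf.sub (.const _)) one_pos ha
  have db := db'.inv_conj (bf.add (.const _)) one_pos hb
  have ba := BoundedFun.inv_conj one_pos ha
  have bb := BoundedFun.inv_conj one_pos hb
  have e : ∀ c, f c - k ≠ 0 → f c + k ≠ 0 →
      1 / (starRingEnd ℂ) (f c - k) - 1 / (starRingEnd ℂ) (f c + k) =
        (starRingEnd ℂ) (2 * k / ((f c - k) * (f c + k))) := by
    intro c h1 h2
    rw [← map_one (starRingEnd ℂ), ← map_div₀, ← map_div₀, ← map_sub]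
    congr 1
    field_simp
    ring
  have hk0 : (0 : ℝ) < k := by positivity
  have hlow : ∀ c ∈ D, 2 * k / ((2 * k) * (2 * k)) ≤
      ‖1 / (starRingEnd ℂ) (f c - k) - 1 / (starRingEnd ℂ) (f c + k)‖ := by
    intro c hc
    have h1 := one_pos.trans_le (ha c hc)
    have h2 := one_pos.trans_le (hb c hc)
    rw [e c (norm_pos_iff.1 h1) (norm_pos_iff.1 h2), RCLike.norm_conj, norm_div, norm_mul,
      norm_mul, Complex.norm_ofNat, hk]
    have h3 : ‖f c - k‖ ≤ 2 * k := by
      refine (norm_sub_le _ _).trans ?_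
      rw [hk]
      linarith [hM c hc, show k = M + 1 from rfl]
    have h4 : ‖f c + k‖ ≤ 2 * k := by
      refine (norm_add_le _ _).trans ?_
      rw [hk]
      linarith [hM c hc, show k = M + 1 from rfl]
    have h5 : ‖f c - k‖ * ‖f c + k‖ ≤ 2 * k * (2 * k) := by gcongr
    exact div_le_div_of_nonneg_left (by positivity) (by positivity) h5
  have dd := (da.sub db ba bb).inv_conj (ba.sub bb) (by positivity) hlow
  have bd := BoundedFun.inv_conj (by positivity) hlow
  have ds := dd.real_mul bd (t := 2 * k) (by positivity)
    (by have : k = M + 1 := rfl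
        rw [this]
        intro h
        linarith)
  have dt := ds.add (const (k * k : ℂ)) (bd.const_mul _) (.const _)
  classical
  have du := congr_of_ne (g' := fun c => if f c - k = 0 then f c * f c else _) da' dt
    (bf.sub (.const _)) one_pos ha fun c hc => if_neg hc
  refine congr_of_ne db' du (bf.add (.const _)) one_pos hb fun c hc => ?_
  split_ifs with h
  · rfl
  · rw [e c h hc, Complex.conj_conj]
    have hk1 : (k : ℂ) ≠ 0 := Complex.ofReal_ne_zero.2 hk0.ne'
    push_cast
    field_simp
    ring

theorem mul (hf : Derivable D F f) (hg : Derivable D F g) (bf : BoundedFun D f)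
    (bg : BoundedFun D g) : Derivable D F (fun c => f c * g c) := by
  have bs := bf.add bg
  have bd := bf.sub bg
  have := (((hf.add hg bf bg).sq bs).sub ((hf.sub hg bf bg).sq bd) (bs.mul bs) (bd.mul bd)).real_mul
    ((bs.mul bs).sub (bd.mul bd)) (t := 1 / 4) (by norm_num) (by norm_num)
  convert this using 2 with c
  push_cast
  ring

/-- Polynomial functions are derivable from the coordinates over bounded sets. -/
theorem aeval (hF : ∀ k : K, (fun c : K → ℂ => c k) ∈ F)
    (hD : ∀ k : K, BoundedFun D (fun c => c k)) (p : MvPolynomial K ℂ) :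
    Derivable D F (fun c => MvPolynomial.aeval c p) ∧
      BoundedFun D (fun c => MvPolynomial.aeval c p) := by
  induction p using MvPolynomial.induction_on with
  | C a =>
    simp only [MvPolynomial.aeval_C, Algebra.algebraMap_self, RingHom.id_apply]
    exact ⟨const a, .const a⟩
  | add p q hp hq =>
    simp only [map_add]
    exact ⟨hp.1.add hq.1 hp.2 hq.2, hp.2.add hq.2⟩
  | mul_X p k hp =>
    simp only [map_mul, MvPolynomial.aeval_X]
    exact ⟨hp.1.mul (of_mem (hF k)) hp.2 (hD k), hp.2.mul (hD k)⟩

theorem realizable_union (h : Realizable D F) {T : Set ((K → ℂ) → ℂ)} (hT : T.Finite)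
    (hd : ∀ f ∈ T, Derivable D F f) : Realizable D (T ∪ F) := by
  induction T, hT using Set.Finite.induction_on with
  | empty => simpa using h
  | @insert f T _ _ ih =>
    rw [Set.insert_union]
    exact hd f (Set.mem_insert _ _) _ Set.subset_union_right
      (ih fun g hg => hd g (Set.mem_insert_of_mem _ hg))

end Derivable

theorem theoremB {m : ℕ} (S U : Set (Fin m → ℂ))
    (hS : IsComplexAlgebraicSet S)
    (hU : ∃ O : Set (Fin m → ℂ), IsOpen O ∧ U = S ∩ O)
    (hUb : Bornology.IsBounded U) :
    ∃ (V : Type) (_ : Fintype V) (L : MarkedLinkage V) (Z : Fin L.numFixed → ℂ) (P : Fin m ↪ V),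
      IsAnalyticallyTrivialPolynomialCoveringOver (inputMap P) (L.configSpace Z) S U := by
  rcases U.eq_empty_or_nonempty with rfl | hne
  · exact exists_covering_empty S
  obtain ⟨I, rfl⟩ := hS
  obtain ⟨O, -, hO⟩ := hU
  obtain ⟨B, hB⟩ := IsNoetherian.noetherian I
  have hb : ∀ k : Fin m, BoundedFun U (fun c => c k) := by
    obtain ⟨M, hM⟩ := hUb.exists_norm_le
    exact fun k => ⟨M, fun c hc => (norm_le_pi_norm c k).trans (hM c hc)⟩
  let T : Set ((Fin m → ℂ) → ℂ) := (fun p c => MvPolynomial.aeval c p) ''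
    (B : Set (MvPolynomial (Fin m) ℂ))
  have hT := Derivable.realizable_union (Realizable.coordinates U) (B.finite_toSet.image _)
    (T := T) (by
      rintro _ ⟨p, -, rfl⟩
      exact (Derivable.aeval (fun k => Set.mem_range_self k) hb p).1)
  have key : MvPolynomial.zeroLocus ℂ I = {c | ∀ f ∈ T, f c = 0} := by
    rw [← hB, Ideal.submodule_span_eq, MvPolynomial.zeroLocus_span]
    ext c
    simp [T]
  rw [key]
  refine ((hT.const 1).const (-1)).exists_covering hne
    (Set.subset_union_left.trans ((Set.subset_insert _ _).trans (Set.subset_insert _ _)))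
    (by simp) (by simp) ?_
  intro f hf c hc
  have : c ∈ {c | ∀ f ∈ T, f c = 0} := by
    rw [← key]
    exact (hO ▸ hc).1
  exact this f hf
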